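/- All graphs are finite, undirected and loopless, and may have multiple edges. A graph $H$ is a minor of a graph $G$ if a graph isomorphic to $H$ can be obtained from $G$ by removing vertices, removing edges and contracting edges (loops that arise are deleted, parallel edges are kept). For $r\in\mathbb{N}$ let $\theta_r$ be the graph with two vertices and $r$ parallel edges; the $\theta_r$-girth of $G$ is the minimum number of edges of a subgraph of $G$ that contains $\theta_r$ as a minor, and it is infinite if there is no such subgraph. For $\alpha,\beta\in\mathbb{N}$, a graph $G$ is $(\alpha,\beta)$-loosely connected if for all $A,B\subseteq V(G)$ with $A\cup B=V(G)$ and no edge of $G$ between $A\setminus B$ and $B\setminus A$, the inequality $|A\cap B|<\beta$ implies $\min(|A\setminus B|,|B\setminus A|)\le\alpha$. Theorem. There is a constant $c>0$ such that for all integers $r\ge 2$ and $\alpha\ge 1$ and every real number $z\ge 168\cdot\alpha\cdot r\cdot\log_2 r$ the following holds: if a connected graph $G$ with at least $z$ edges is $(\alpha,2r-1)$-loosely connected and has $\theta_r$-girth at least $z$, then $G$ contains as a minor a complete graph on $k$ vertices for some integer $$k\ \ge\ \frac{2^{\,c\cdot\frac{z}{r\alpha}}}{\sqrt{rz}}.$$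 -/

import Mathlib

open scoped Graph

namespace Graph

universe u v u' v'

/-- Two multigraphs are isomorphic: there are bijections between their vertex sets and between
their edge sets that respect the ends of the edges. -/
def IsIsomorphicTo {ν : Type u} {ε : Type v} {ν' : Type u'} {ε' : Type v'}
    (G : Graph ν ε) (H : Graph ν' ε') : Prop :=
  ∃ (f : V(G) ≃ V(H)) (g : E(G) ≃ E(H)), ∀ (e : E(G)) (x y : V(G)),
    G.IsLink e x y ↔ H.IsLink (g e) (f x) (f y)

open Classical in
/-- The contraction, in a loopless multigraph, of an edge with ends `x` and `y`: the vertex `y` is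
identified with `x`, and all the edges between `x` and `y`, which would become loops, disappear.
All other edges are kept, also when they become parallel. -/
noncomputable def contract {ν : Type u} {ε : Type v} (G : Graph ν ε) (x y : ν) : Graph ν ε :=
  (G.deleteEdges {e | G.IsLink e x y}).map (fun w => if w = y then x else w)

/-- One operation: the removal of a vertex, the removal of an edge, or the contraction of
an edge. -/
inductive MinorStep {ν : Type u} {ε : Type v} : Graph ν ε → Graph ν ε → Prop
  | deleteVert (G : Graph ν ε) (x : ν) (hx : x ∈ V(G)) : MinorStep G (G.deleteVerts {x})
  | deleteEdge (G : Graph ν ε) (e : ε) (he : e ∈ E(G)) : MinorStep G (G.deleteEdges {e})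
  | contractEdge (G : Graph ν ε) (e : ε) (x y : ν) (he : G.IsLink e x y) (hxy : x ≠ y) :
      MinorStep G (G.contract x y)

/-- `H` is a minor of `G`: up to isomorphism, `H` is obtained from `G` by finitely many removals of
vertices, removals of edges and contractions of edges. -/
def IsMinorOf {ν : Type u} {ε : Type v} {ν' : Type u'} {ε' : Type v'}
    (H : Graph ν' ε') (G : Graph ν ε) : Prop :=
  ∃ G' : Graph ν ε, Relation.ReflTransGen MinorStep G G' ∧ G'.IsIsomorphicTo H

/-- An `H`-model in `G` is a subgraph of `G` that contains `H` as a minor. -/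
def IsModelIn {ν : Type u} {ε : Type v} {ν' : Type u'} {ε' : Type v'}
    (M : Graph ν ε) (H : Graph ν' ε') (G : Graph ν ε) : Prop :=
  M ≤ G ∧ H.IsMinorOf M

/-- The `H`-girth of `G`: the minimum number of edges of an `H`-model in `G`, which is `⊤` if there
is no such model. -/
noncomputable def minorGirth {ν : Type u} {ε : Type v} {ν' : Type u'} {ε' : Type v'}
    (H : Graph ν' ε') (G : Graph ν ε) : ℕ∞ :=
  ⨅ (M : Graph ν ε) (_ : M.IsModelIn H G), E(M).encard

/-- The graph `θ_r` with two vertices and `r` parallel edges. -/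
def theta (r : ℕ) : Graph (Fin 2) (Fin r) :=
  Graph.banana 0 1 Set.univ

/-- The complete graph of order `k`. -/
def clique (k : ℕ) : Graph (Fin k) (Sym2 (Fin k)) :=
  Graph.ofSimpleGraph (⊤ : SimpleGraph (Fin k))

/-- `(α, β)`-loose connectivity of a finite graph: no separation `(A, B)` of order less than `β`
has more than `α` vertices on both of its sides. -/
def LooselyConnected {ν : Type u} {ε : Type v} (G : Graph ν ε) (α β : ℕ) : Prop :=
  ∀ A B : Set ν, A ∪ B = V(G) → (∀ x ∈ A \ B, ∀ y ∈ B \ A, ¬ G.Adj x y) →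
    (A ∩ B).ncard < β → min (A \ B).ncard (B \ A).ncard ≤ α

end Graph

/-! ### Connected vertex sets, described by closed subsets instead of walks. -/

namespace Graph

universe u v u₂ v₂

/-! Put $N=\lceil z\rceil$. If $r$ edges join two disjoint connected sets, spanning trees of the
sets together with these edges form a $\theta_r$-model, so the sets have about $N$ vertices in total
(`thetaSparse_of_le_minorGirth`). Hence disjoint connected sets whose radius is a small multiple of
$z/r$ have fewer than $r$ edges between them (`ThetaSparse.ncard_between_lt`). Loose connectivity,
in turn, forbids edge cuts of at most $2r-2$ edges with more than $\alpha$ vertices on both sides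
(`LooselyConnected.false_of_cut`), once $G$ has enough vertices (`ThetaSparse.le_ncard_vertexSet`).

Take $\ell\approx z/(8r)$ and breadth-first trees around a maximal set of roots at pairwise distance
more than $2\ell$; edges leave a tree only from depth at least $\ell$ on (`exists_isForest`). Call a
subtree heavy if it has more than $\alpha$ vertices. Every tree has a heavy subtree starting at
depth $\alpha+1$ (`IsForest.exists_heavy`). If a heavy subtree had only one heavy subtree $\alpha+1$
levels further down, the piece between the two would be cut off by $2(r-1)$ edges; so there are two
(`IsForest.exists_two_below`). Thus the number of edges leaving a tree doubles every $\alpha+1$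
levels, up to $2^j$ with $j\approx\ell/(2\alpha)$ (`IsForest.two_pow_le_ncard_between`).

Two trees are joined by fewer than $r$ edges, so contracting the trees gives a simple graph of
minimum degree at least $2^j/r$, exponential in $z/(r\alpha)$. A graph whose average degree is of
order $k^3$ has a $K_k$ minor, by Mader's argument (`IsMinorModel.hasCliqueModel_of_le`); the cubic
loss only affects $c$. -/

/-- A set is connected for the relation `A` if it is contained in every set that it meets and that
is closed, inside it, under `A`. The empty set is connected. -/
def Conn {ν : Type u} (A : ν → ν → Prop) (S : Set ν) : Prop :=
  ∀ Y : Set ν, (S ∩ Y).Nonempty → (∀ x ∈ S, x ∈ Y → ∀ y ∈ S, A x y → y ∈ Y) → S ⊆ Y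

section Conn

variable {ν : Type u} {A K : ν → ν → Prop} {S T : Set ν}

lemma conn_empty : Conn A (∅ : Set ν) := fun _ _ _ => Set.empty_subset _

lemma conn_singleton (x : ν) : Conn A {x} := by
  rintro Y ⟨y, rfl, hy⟩ -
  simpa using hy

lemma Conn.exists_adj (h : Conn A S) {X : Set ν} (hX : (S ∩ X).Nonempty) {y : ν} (hy : y ∈ S)
    (hyX : y ∉ X) : ∃ a ∈ S, a ∈ X ∧ ∃ b ∈ S, b ∉ X ∧ A a b := by
  by_contra! hc
  exact hyX (h X hX (fun a ha haX b hb hab => by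
    by_contra hbX
    exact hc a ha haX b hb hbX hab) hy)

lemma Conn.union_of_adj (hA : ∀ x y, A x y → A y x) (hS : Conn A S) (hT : Conn A T) {x y : ν}
    (hx : x ∈ S) (hy : y ∈ T) (hxy : A x y) : Conn A (S ∪ T) := by
  intro Y hY hcl
  have h1 : (S ∩ Y).Nonempty → S ⊆ Y := fun h => hS Y h
    (fun a ha haY b hb hab => hcl a (Or.inl ha) haY b (Or.inl hb) hab)
  have h2 : (T ∩ Y).Nonempty → T ⊆ Y := fun h => hT Y h
    (fun a ha haY b hb hab => hcl a (Or.inr ha) haY b (Or.inr hb) hab)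
  obtain ⟨w, hw | hw, hwY⟩ := hY
  · have := h1 ⟨w, hw, hwY⟩
    exact Set.union_subset this (h2 ⟨y, hy, hcl x (Or.inl hx) (this hx) y (Or.inr hy) hxy⟩)
  · have := h2 ⟨w, hw, hwY⟩
    exact Set.union_subset
      (h1 ⟨x, hx, hcl y (Or.inr hy) (this hy) x (Or.inl hx) (hA _ _ hxy)⟩) this

lemma Conn.insert_of_adj (hA : ∀ x y, A x y → A y x) (hS : Conn A S) {x y : ν}
    (hx : x ∈ S) (hxy : A x y) : Conn A (insert y S) := by
  rw [Set.insert_eq, Set.union_comm]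
  exact hS.union_of_adj hA (conn_singleton y) hx rfl hxy

lemma conn_biUnion {ι : Type v} {I : Set ι} {D : ι → Set ν} {t : ν}
    (hD : ∀ i ∈ I, Conn A (D i)) (ht : ∀ i ∈ I, t ∈ D i) : Conn A (⋃ i ∈ I, D i) := by
  rintro Y ⟨y, hy, hyY⟩ hcl
  have h1 : ∀ i ∈ I, (D i ∩ Y).Nonempty → D i ⊆ Y := fun i hi h => hD i hi Y h
    (fun a ha haY b hb hab => hcl a (Set.mem_biUnion hi ha) haY b (Set.mem_biUnion hi hb) hab)
  obtain ⟨i, hi, hyi⟩ := Set.mem_iUnion₂.1 hy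
  have htY : t ∈ Y := h1 i hi ⟨y, hyi, hyY⟩ (ht i hi)
  exact Set.iUnion₂_subset fun j hj => h1 j hj ⟨t, ht j hj, htY⟩

/-- Used to compose minors: `K` is the adjacency of a contracted graph and `B w` the branch set of
its vertex `w`. -/
lemma Conn.biUnion (hS : Conn K S) {B : ν → Set ν} (hB : ∀ w ∈ S, Conn A (B w))
    (hK : ∀ w ∈ S, ∀ w' ∈ S, K w w' → ∃ x ∈ B w, ∃ y ∈ B w', A x y) :
    Conn A (⋃ w ∈ S, B w) := by
  rintro Y ⟨y, hy, hyY⟩ hcl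
  have h1 : ∀ w ∈ S, (B w ∩ Y).Nonempty → B w ⊆ Y := fun i hi h => hB i hi Y h
    (fun a ha haY b hb hab => hcl a (Set.mem_biUnion hi ha) haY b (Set.mem_biUnion hi hb) hab)
  obtain ⟨i, hi, hyi⟩ := Set.mem_iUnion₂.1 hy
  have h2 : S ⊆ {w | B w ⊆ Y} := by
    refine hS _ ⟨i, hi, h1 i hi ⟨y, hyi, hyY⟩⟩ ?_
    intro w hw hwY w' hw' hww'
    obtain ⟨a, ha, b, hb, hab⟩ := hK w hw w' hw' hww'
    exact h1 w' hw' ⟨b, hb, hcl a (Set.mem_biUnion hw ha) (hwY ha) b (Set.mem_biUnion hw' hb) hab⟩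
  exact Set.iUnion₂_subset fun j hj => h2 hj

lemma Conn.mono (hS : Conn A S) (h : ∀ x ∈ S, ∀ y ∈ S, A x y → K x y) : Conn K S :=
  fun Y hY hcl => hS Y hY fun x hx hxY y hy hxy => hcl x hx hxY y hy (h x hx y hy hxy)

end Conn

/-! ### Minors from branch sets. -/

section Minor

variable {ν : Type u} {ε : Type v} {ν' : Type u₂} {ε' : Type v₂} {G : Graph ν ε}

/-- The graph obtained by identifying the vertices with the same image under `φ`; the edges that
would become loops are removed. -/
noncomputable def collapse (G : Graph ν ε) (φ : ν → ν) : Graph ν ε :=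
  (G.deleteEdges {e | ∃ x y, G.IsLink e x y ∧ φ x = φ y}).map φ

lemma collapse_isLink {φ : ν → ν} {e : ε} {a b : ν} :
    (G.collapse φ).IsLink e a b ↔ ∃ x y, G.IsLink e x y ∧ φ x = a ∧ φ y = b ∧ a ≠ b := by
  constructor
  · rintro ⟨x, y, h, rfl, rfl⟩
    simp only [deleteEdges_isLink, Set.mem_ofPred_eq] at h
    exact ⟨x, y, h.1, rfl, rfl, fun h' => h.2 ⟨x, y, h.1, h'⟩⟩
  · rintro ⟨x, y, h, rfl, rfl, hne⟩
    refine ⟨x, y, ?_, rfl, rfl⟩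
    simp only [deleteEdges_isLink, Set.mem_ofPred_eq]
    refine ⟨h, ?_⟩
    rintro ⟨x', y', h', heq⟩
    rcases h.eq_and_eq_or_eq_and_eq h' with ⟨rfl, rfl⟩ | ⟨rfl, rfl⟩
    · exact hne heq
    · exact hne heq.symm

lemma vertexSet_collapse {φ : ν → ν} : V(G.collapse φ) = φ '' V(G) := by
  simp [collapse]

lemma contract_isLink {x y : ν} {e : ε} {a b : ν} :
    (G.contract x y).IsLink e a b ↔ ∃ u v, G.IsLink e u v ∧ ¬ G.IsLink e x y ∧
      (open Classical in if u = y then x else u) = a ∧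
      (open Classical in if v = y then x else v) = b := by
  simp only [contract, map_isLink, Relation.Map, deleteEdges_isLink, Set.mem_ofPred_eq, and_assoc]

-- Collapses are stable under contraction, so a sequence of contractions is recorded by a single map
-- on the vertices.
open Classical in
lemma collapse_contract {φ : ν → ν} {e : ε} {a b : ν} (h : (G.collapse φ).IsLink e a b) :
    (G.collapse φ).contract a b = G.collapse (fun w => if φ w = b then a else φ w) := by
  have hab : a ≠ b := by
    obtain ⟨_, _, _, _, _, h⟩ := collapse_isLink.1 h
    exact h
  refine Graph.ext ?_ ?_
  · simp only [contract, vertexSet_collapse, vertexSet_map, vertexSet_deleteEdges, Set.image_image]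
  · intro f s t
    simp only [contract_isLink, collapse_isLink]
    constructor
    · rintro ⟨u, v, ⟨x, y, hxy, rfl, rfl, hne⟩, hn, rfl, rfl⟩
      refine ⟨x, y, hxy, rfl, rfl, ?_⟩
      have h1 : ¬ (φ x = a ∧ φ y = b) := fun h' => hn ⟨x, y, hxy, h'.1, h'.2, hab⟩
      have h2 : ¬ (φ y = a ∧ φ x = b) := fun h' => hn ⟨y, x, hxy.symm, h'.1, h'.2, hab⟩
      grind
    · rintro ⟨x, y, hxy, rfl, rfl, hne⟩
      refine ⟨φ x, φ y, ⟨x, y, hxy, rfl, rfl, by grind⟩, ?_, rfl, rfl⟩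
      rintro ⟨x', y', h', h1, h2, -⟩
      rcases hxy.eq_and_eq_or_eq_and_eq h' with ⟨rfl, rfl⟩ | ⟨rfl, rfl⟩
      · grind
      · grind

lemma reflTransGen_deleteVerts {D : Set ν} (hD : D.Finite) (hDV : D ⊆ V(G)) :
    Relation.ReflTransGen MinorStep G (G.deleteVerts D) := by
  induction D, hD using Set.Finite.induction_on with
  | empty => simpa using Relation.ReflTransGen.refl
  | @insert a s ha hs ih =>
    refine (ih ((Set.subset_insert _ _).trans hDV)).tail ?_
    have := MinorStep.deleteVert (G.deleteVerts s) a (by simp [ha, hDV (Set.mem_insert _ _)])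
    convert this using 1
    refine Graph.ext ?_ ?_
    · ext x; simp; tauto
    · intro e x y
      simp only [deleteVerts_isLink, Set.mem_insert_iff, Set.mem_singleton_iff]
      tauto

lemma reflTransGen_deleteEdges {F : Set ε} (hF : F.Finite) (hFE : F ⊆ E(G)) :
    Relation.ReflTransGen MinorStep G (G.deleteEdges F) := by
  induction F, hF using Set.Finite.induction_on with
  | empty => simpa using Relation.ReflTransGen.refl
  | @insert a s ha hs ih =>
    refine (ih ((Set.subset_insert _ _).trans hFE)).tail ?_
    have := MinorStep.deleteEdge (G.deleteEdges s) a (by simp [ha, hFE (Set.mem_insert _ _)])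
    convert this using 1
    rw [deleteEdges_deleteEdges, Set.union_singleton]

open Classical in
/-- Collapsing connected fibres is a sequence of contractions. -/
lemma reflTransGen_collapse (hfin : V(G).Finite) (hl : G.Loopless) (ρ : ν → ν) (R : Set ν)
    (hRV : R ⊆ V(G)) (hρ : ∀ x ∈ V(G), ρ x ∈ R) (hR : ∀ x ∈ R, ρ x = x)
    (hconn : ∀ t ∈ R, Conn G.Adj {y | y ∈ V(G) ∧ ρ y = t}) :
    Relation.ReflTransGen MinorStep G (G.collapse ρ) := by
  -- `C` consists of the vertices already sent to their representatives; the others are still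
  -- untouched. A maximal reachable `C` is all of `V(G)`, since otherwise an edge inside a fibre
  -- leaves `C` and can be contracted next.
  let φ : Set ν → ν → ν := fun C x => if x ∈ C then ρ x else x
  let P : Set ν → Prop := fun C => R ⊆ C ∧ C ⊆ V(G) ∧
    Relation.ReflTransGen MinorStep G (G.collapse (φ C))
  have hP0 : P R := by
    refine ⟨subset_rfl, hRV, ?_⟩
    have h0 : φ R = id := by
      funext x
      by_cases hx : x ∈ R
      · simp [φ, hx, hR x hx]
      · simp [φ, hx]
    have : G.collapse (φ R) = G := by
      rw [h0]
      refine Graph.ext (by simp [vertexSet_collapse]) ?_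
      intro e x y
      rw [collapse_isLink]
      constructor
      · rintro ⟨_, _, h, rfl, rfl, _⟩; exact h
      · intro h; exact ⟨x, y, h, rfl, rfl, h.ne⟩
    rw [this]
  have hPfin : {C | P C}.Finite := hfin.finite_subsets.subset fun C hC => hC.2.1
  obtain ⟨C, hC⟩ := hPfin.exists_maximal ⟨R, hP0⟩
  have hCeq : C = V(G) := by
    by_contra hne
    obtain ⟨x, hxV, hxC⟩ := Set.exists_of_ssubset (hC.1.2.1.ssubset_of_ne hne)
    obtain ⟨a, ⟨haV, hat⟩, haC, b, ⟨hbV, hbt⟩, hbC, hab⟩ :=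
      (hconn (ρ x) (hρ x hxV)).exists_adj (X := C)
      ⟨ρ x, ⟨hRV (hρ x hxV), hR _ (hρ x hxV)⟩, hC.1.1 (hρ x hxV)⟩ ⟨hxV, rfl⟩ hxC
    obtain ⟨e, he⟩ := hab
    have hρb : ρ x ≠ b := fun h => hbC (h ▸ hC.1.1 (hρ x hxV))
    have hl : (G.collapse (φ C)).IsLink e (ρ x) b :=
      collapse_isLink.2 ⟨a, b, he, by simp [φ, haC, hat], by simp [φ, hbC], hρb⟩
    have hPn : P (insert b C) := by
      refine ⟨hC.1.1.trans (Set.subset_insert _ _), Set.insert_subset hbV hC.1.2.1,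
        hC.1.2.2.tail ?_⟩
      have := MinorStep.contractEdge _ e (ρ x) b hl hρb
      rw [collapse_contract hl] at this
      convert this using 2
      funext w
      by_cases hwC : w ∈ C
      · have h1 : ρ w ≠ b := fun h => hbC (h ▸ hC.1.1 (hρ w (hC.1.2.1 hwC)))
        simp [φ, hwC, h1]
      · by_cases hwb : w = b
        · subst hwb; simp [φ, hbC, hbt]
        · simp [φ, hwC, hwb]
    exact hbC (hC.le_of_ge hPn (Set.subset_insert _ _) (Set.mem_insert _ _))
  have h2 : G.collapse (φ C) = G.collapse ρ := by
    refine Graph.ext ?_ ?_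
    · rw [vertexSet_collapse, vertexSet_collapse]
      refine Set.image_congr fun x hx => ?_
      simp [φ, hCeq, hx]
    · intro e x y
      rw [collapse_isLink, collapse_isLink]
      constructor
      · rintro ⟨u, v, h, h1, h2, h3⟩
        refine ⟨u, v, h, ?_, ?_, h3⟩
        · simpa [φ, hCeq, h.left_mem] using h1
        · simpa [φ, hCeq, h.right_mem] using h2
      · rintro ⟨u, v, h, h1, h2, h3⟩
        refine ⟨u, v, h, ?_, ?_, h3⟩
        · simpa [φ, hCeq, h.left_mem] using h1
        · simpa [φ, hCeq, h.right_mem] using h2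
  rw [← h2]
  exact hC.1.2.2

open Classical in
/-- A family of disjoint connected branch sets with an edge for each edge of `H` gives a minor. -/
theorem isMinorOf_of_branchSets (hfin : V(G).Finite) (hEfin : E(G).Finite) (hl : G.Loopless)
    (H : Graph ν' ε') (B : ν' → Set ν) (hHl : H.Loopless)
    (hH : V(H).Nonempty)
    (hne : ∀ v ∈ V(H), (B v).Nonempty) (hBV : ∀ v ∈ V(H), B v ⊆ V(G))
    (hconn : ∀ v ∈ V(H), Conn G.Adj (B v))
    (hdisj : ∀ v ∈ V(H), ∀ w ∈ V(H), v ≠ w → Disjoint (B v) (B w))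
    (η : ε' → ε) (hη : Set.InjOn η E(H))
    (hlink : ∀ e x y, H.IsLink e x y → ∃ a ∈ B x, ∃ b ∈ B y, G.IsLink (η e) a b) :
    H.IsMinorOf G := by
  have : Nonempty ν' := ⟨hH.some⟩
  have : Nonempty ν := ⟨(hne _ hH.some_mem).some⟩
  choose! b hb using hne
  let W : Set ν := ⋃ v ∈ V(H), B v
  have hWV : W ⊆ V(G) := Set.iUnion₂_subset hBV
  have huniq : ∀ v ∈ V(H), ∀ w ∈ V(H), ∀ x, x ∈ B v → x ∈ B w → v = w := by
    intro v hv w hw x hx hx'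
    by_contra h
    exact Set.disjoint_left.1 (hdisj v hv w hw h) hx hx'
  have hW : ∀ x ∈ W, ∃ v ∈ V(H), x ∈ B v := fun x hx => by simpa [W] using hx
  choose! π hπV hπB using hW
  have hπ : ∀ v ∈ V(H), ∀ x ∈ B v, π x = v := fun v hv x hx =>
    huniq _ (hπV x (Set.mem_biUnion hv hx)) _ hv x (hπB x (Set.mem_biUnion hv hx)) hx
  let ρ : ν → ν := fun x => b (π x)
  -- Three stages: delete the vertices outside the branch sets, collapse each branch set to its
  -- representative, delete the edges that are not values of `η` on `E(H)`.
  let G₁ := G.deleteVerts (V(G) \ W)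
  have hV1 : V(G₁) = W := by
    simp [G₁, Set.inter_eq_right.2 hWV]
  have hlink1 : ∀ e x y, G₁.IsLink e x y ↔ G.IsLink e x y ∧ x ∈ W ∧ y ∈ W := by
    intro e x y
    simp only [G₁, deleteVerts_isLink, Set.mem_sdiff]
    constructor
    · rintro ⟨h, h1, h2⟩
      have := h.left_mem
      have := h.right_mem
      tauto
    · tauto
  have hG1 : Relation.ReflTransGen MinorStep G G₁ :=
    reflTransGen_deleteVerts (hfin.subset Set.sdiff_subset) Set.sdiff_subset
  have hl1 : G₁.Loopless := Loopless.anti (G := G) deleteVerts_le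
  have hG2 : Relation.ReflTransGen MinorStep G₁ (G₁.collapse ρ) := by
    refine reflTransGen_collapse (hV1 ▸ hfin.subset hWV) hl1 ρ (b '' V(H)) ?_ ?_ ?_ ?_
    · rintro _ ⟨v, hv, rfl⟩
      rw [hV1]
      exact Set.mem_biUnion hv (hb v hv)
    · intro x hx
      rw [hV1] at hx
      exact ⟨π x, hπV x hx, rfl⟩
    · rintro _ ⟨v, hv, rfl⟩
      simp only [ρ]
      rw [hπ v hv _ (hb v hv)]
    · rintro _ ⟨v, hv, rfl⟩
      have : {y | y ∈ V(G₁) ∧ ρ y = b v} = B v := by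
        ext y
        rw [Set.mem_ofPred_eq, hV1]
        constructor
        · rintro ⟨hy, h⟩
          have h1 := hb (π y) (hπV y hy)
          have : b (π y) = b v := h
          rw [this] at h1
          rw [huniq v hv _ (hπV y hy) _ (hb v hv) h1]
          exact hπB y hy
        · intro hy
          exact ⟨Set.mem_biUnion hv hy, by simp only [ρ]; rw [hπ v hv y hy]⟩
      rw [this]
      refine (hconn v hv).mono ?_
      rintro x hx y hy ⟨e, he⟩
      exact ⟨e, (hlink1 e x y).2 ⟨he, Set.mem_biUnion hv hx, Set.mem_biUnion hv hy⟩⟩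
  have hbinj : ∀ v ∈ V(H), ∀ w ∈ V(H), b v = b w → v = w := fun v hv w hw h =>
    huniq v hv w hw _ (hb v hv) (h ▸ hb w hw)
  let G₂ := G₁.collapse ρ
  have hlink2 : ∀ e x y, H.IsLink e x y → G₂.IsLink (η e) (b x) (b y) := by
    intro e x y he
    obtain ⟨a, ha, c, hc, h⟩ := hlink e x y he
    have hx := he.left_mem
    have hy := he.right_mem
    refine collapse_isLink.2 ⟨a, c, (hlink1 _ _ _).2
      ⟨h, Set.mem_biUnion hx ha, Set.mem_biUnion hy hc⟩, ?_, ?_, ?_⟩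
    · simp only [ρ]; rw [hπ x hx a ha]
    · simp only [ρ]; rw [hπ y hy c hc]
    · exact fun h => he.ne (hbinj _ hx _ hy h)
  have hE2 : E(G₂) ⊆ E(G) := by
    intro e he
    obtain ⟨x, y, h⟩ := exists_isLink_of_mem_edgeSet he
    obtain ⟨u, v, h, -⟩ := collapse_isLink.1 h
    exact ((hlink1 _ _ _).1 h).1.edge_mem
  let G₃ := G₂.deleteEdges (E(G₂) \ η '' E(H))
  have hG3 : Relation.ReflTransGen MinorStep G₂ G₃ :=
    reflTransGen_deleteEdges ((hEfin.subset hE2).subset Set.sdiff_subset) Set.sdiff_subset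
  have hV3 : V(G₃) = b '' V(H) := by
    simp only [G₃, vertexSet_deleteEdges, G₂, vertexSet_collapse, hV1]
    ext t
    constructor
    · rintro ⟨x, hx, rfl⟩
      exact ⟨π x, hπV x hx, rfl⟩
    · rintro ⟨v, hv, rfl⟩
      exact ⟨b v, Set.mem_biUnion hv (hb v hv), by simp only [ρ]; rw [hπ v hv _ (hb v hv)]⟩
  have hE3 : E(G₃) = η '' E(H) := by
    simp only [G₃, edgeSet_deleteEdges, Set.sdiff_sdiff_right_self]
    refine Set.inter_eq_right.2 ?_
    rintro _ ⟨e, he, rfl⟩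
    obtain ⟨x, y, h⟩ := exists_isLink_of_mem_edgeSet he
    exact (hlink2 e x y h).edge_mem
  have hlink3 : ∀ e ∈ E(H), ∀ x ∈ V(H), ∀ y ∈ V(H),
      G₃.IsLink (η e) (b x) (b y) ↔ H.IsLink e x y := by
    intro e he x hx y hy
    obtain ⟨x', y', h⟩ := exists_isLink_of_mem_edgeSet he
    have h3 : G₃.IsLink (η e) (b x') (b y') := by
      simp only [G₃, deleteEdges_isLink]
      exact ⟨hlink2 e _ _ h, fun h => h.2 ⟨e, he, rfl⟩⟩
    rw [h3.isLink_iff, h.isLink_iff]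
    have := hbinj _ hx _ h.left_mem
    have := hbinj _ hx _ h.right_mem
    have := hbinj _ hy _ h.left_mem
    have := hbinj _ hy _ h.right_mem
    have := hbinj _ h.left_mem _ hx
    have := hbinj _ h.right_mem _ hx
    have := hbinj _ h.left_mem _ hy
    have := hbinj _ h.right_mem _ hy
    grind
  refine ⟨G₃, (hG1.trans hG2).trans hG3, ?_⟩
  have hbI : Set.InjOn b V(H) := fun v hv w hw h => hbinj v hv w hw h
  let f : V(H) ≃ V(G₃) := (Equiv.Set.imageOfInjOn b V(H) hbI).trans (Equiv.setCongr hV3.symm)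
  let g : E(H) ≃ E(G₃) := (Equiv.Set.imageOfInjOn η E(H) hη).trans (Equiv.setCongr hE3.symm)
  refine ⟨f.symm, g.symm, ?_⟩
  intro e x y
  obtain ⟨e, rfl⟩ := g.surjective e
  obtain ⟨x, rfl⟩ := f.surjective x
  obtain ⟨y, rfl⟩ := f.surjective y
  simp only [Equiv.symm_apply_apply]
  exact hlink3 e e.2 x x.2 y y.2

end Minor

end Graph

/-! ### Components, edges between two sets, and clique minors from branch sets. -/

namespace Graph

universe u v

section Component

variable {ν : Type u} {A : ν → ν → Prop} {S W : Set ν}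

/-- `X` is closed under `A` inside `S`. -/
def ClosedIn (A : ν → ν → Prop) (S X : Set ν) : Prop :=
  ∀ x ∈ X, ∀ y ∈ S, A x y → y ∈ X

lemma exists_component (hA : ∀ x y, A x y → A y x) {x : ν} (hx : x ∈ W) :
    ∃ C ⊆ W, x ∈ C ∧ Conn A C ∧ ClosedIn A W C := by
  have hC : Conn A (⋃ D ∈ {D | D ⊆ W ∧ x ∈ D ∧ Conn A D}, D) :=
    conn_biUnion (t := x) (fun D hD => hD.2.2) (fun D hD => hD.2.1)
  have hCW : (⋃ D ∈ {D | D ⊆ W ∧ x ∈ D ∧ Conn A D}, D) ⊆ W :=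
    Set.iUnion₂_subset fun D hD => hD.1
  have hxC : x ∈ (⋃ D ∈ {D | D ⊆ W ∧ x ∈ D ∧ Conn A D}, D) :=
    Set.mem_biUnion (x := {x}) ⟨by simpa using hx, rfl, conn_singleton x⟩ rfl
  refine ⟨_, hCW, hxC, hC, ?_⟩
  intro a ha b hb hab
  exact Set.mem_biUnion (x := insert b _)
    ⟨Set.insert_subset hb hCW, Set.mem_insert_of_mem _ hxC, hC.insert_of_adj hA ha hab⟩
    (Set.mem_insert _ _)

/-- If every set that is closed in `S` is small or has a small complement, then some connected
closed set has a small complement. -/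
lemma exists_giant (hA : ∀ x y, A x y → A y x) (hS : S.Finite) {a : ℕ}
    (h : ∀ X ⊆ S, ClosedIn A S X → X.ncard ≤ a ∨ (S \ X).ncard ≤ a) (hcard : 3 * a < S.ncard) :
    ∃ D ⊆ S, Conn A D ∧ ClosedIn A S D ∧ (S \ D).ncard ≤ a := by
  have hfin : {X | X ⊆ S ∧ ClosedIn A S X ∧ a < X.ncard}.Finite :=
    hS.finite_subsets.subset fun X hX => hX.1
  -- Take a minimal closed set `Y` with more than `a` vertices. A splitting of `Y` into two closed
  -- parts would leave at most `a` vertices in each by minimality, and at most `a` lie outside `Y`,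
  -- contradicting `hcard`.
  obtain ⟨Y, hY⟩ := hfin.exists_minimal
    ⟨S, subset_rfl, fun _ _ y hy _ => hy, by lia⟩
  obtain ⟨⟨hYS, hYcl, hYa⟩, hmin⟩ := hY
  refine ⟨Y, hYS, ?_, hYcl, (h Y hYS hYcl).resolve_left (by lia)⟩
  have hYfin := hS.subset hYS
  intro Z hZ hcl
  by_contra hn
  have h1 : ClosedIn A S (Y ∩ Z) := fun x hx y hy hxy =>
    have := hYcl x hx.1 y hy hxy
    ⟨this, hcl x hx.1 hx.2 y this hxy⟩
  have h2 : ClosedIn A S (Y \ Z) := fun x hx y hy hxy =>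
    have hyY := hYcl x hx.1 y hy hxy
    ⟨hyY, fun hyZ => hx.2 (hcl y hyY hyZ x hx.1 (hA _ _ hxy))⟩
  have h3 : (Y ∩ Z).ncard ≤ a := by
    by_contra hc
    exact hn ((hmin ⟨Set.inter_subset_left.trans hYS, h1, by lia⟩
      Set.inter_subset_left).trans Set.inter_subset_right)
  have h4 : (Y \ Z).ncard ≤ a := by
    by_contra hc
    obtain ⟨y, hy, hyZ⟩ := hZ
    exact (hmin ⟨Set.sdiff_subset.trans hYS, h2, by lia⟩ Set.sdiff_subset hy).2 hyZ
  have h5 := Set.ncard_inter_add_ncard_sdiff_eq_ncard Y Z hYfin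
  have h6 := Set.ncard_sdiff_add_ncard_of_subset hYS hS
  have := h Y hYS hYcl
  lia

/-- A maximal connected proper subset misses exactly one vertex, since otherwise an adjacent vertex
could be added to it. Such a vertex plays the role of a leaf of a spanning tree. -/
lemma Conn.exists_eq_insert (hA : ∀ x y, A x y → A y x) (hS : Conn A S) (hfin : S.Finite)
    (hne : S.Nonempty) : ∃ w D, w ∉ D ∧ S = insert w D ∧ Conn A D := by
  have hPfin : {D | D ⊆ S ∧ D ≠ S ∧ Conn A D}.Finite :=
    hfin.finite_subsets.subset fun X hX => hX.1
  obtain ⟨D, ⟨hDS, hDne, hD⟩, hmax⟩ := hPfin.exists_maximal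
    ⟨∅, Set.empty_subset _, hne.ne_empty.symm, conn_empty⟩
  obtain ⟨y, hyS, hyD⟩ := Set.exists_of_ssubset (hDS.ssubset_of_ne hDne)
  have key : ∃ w ∈ S, w ∉ D ∧ Conn A (insert w D) := by
    rcases D.eq_empty_or_nonempty with rfl | ⟨x, hx⟩
    · exact ⟨y, hyS, hyD, by simpa using conn_singleton y⟩
    · obtain ⟨a, -, haD, b, hbS, hbD, hab⟩ := hS.exists_adj ⟨x, hDS hx, hx⟩ hyS hyD
      exact ⟨b, hbS, hbD, hD.insert_of_adj hA haD hab⟩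
  obtain ⟨w, hwS, hwD, hw⟩ := key
  refine ⟨w, D, hwD, ?_, hD⟩
  by_contra hn
  exact hwD (hmax ⟨Set.insert_subset hwS hDS, fun h => hn h.symm, hw⟩ (Set.subset_insert _ _)
    (Set.mem_insert _ _))

end Component

variable {ν : Type u} {ε : Type v} {G : Graph ν ε}

lemma adj_symm (G : Graph ν ε) : ∀ x y, G.Adj x y → G.Adj y x := fun _ _ h => h.symm

lemma conn_vertexSet (h : G.toSimpleGraph.Connected) : Conn G.Adj V(G) := by
  rintro Y ⟨x, hxV, hxY⟩ hcl y hy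
  obtain ⟨p⟩ := h.preconnected ⟨x, hxV⟩ ⟨y, hy⟩
  have : ∀ (a b : V(G)) (p : G.toSimpleGraph.Walk a b), (a : ν) ∈ Y → (b : ν) ∈ Y := by
    intro a b p
    induction p with
    | nil => exact id
    | @cons u v w huv _ ih => exact fun hu => ih (hcl u u.2 hu v v.2 huv.2)
  exact this _ _ p hxY

/-- The edges with one end in `S` and the other in `U`. -/
def between (G : Graph ν ε) (S U : Set ν) : Set ε :=
  {e | ∃ x ∈ S, ∃ y ∈ U, G.IsLink e x y}

section Between

lemma between_subset (S U : Set ν) : G.between S U ⊆ E(G) := by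
  rintro e ⟨x, -, y, -, h⟩
  exact h.edge_mem

lemma between_mono {S S' U U' : Set ν} (h : S ⊆ S') (h' : U ⊆ U') :
    G.between S U ⊆ G.between S' U' := by
  rintro e ⟨x, hx, y, hy, he⟩
  exact ⟨x, h hx, y, h' hy, he⟩

lemma between_comm (S U : Set ν) : G.between S U = G.between U S := by
  ext e
  constructor <;> rintro ⟨x, hx, y, hy, he⟩ <;> exact ⟨y, hy, x, hx, he.symm⟩

lemma between_vertexSet : G.between V(G) V(G) = E(G) := by
  refine (between_subset _ _).antisymm fun e he => ?_
  obtain ⟨x, y, h⟩ := exists_isLink_of_mem_edgeSet he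
  exact ⟨x, h.left_mem, y, h.right_mem, h⟩

lemma between_union_right (S U U' : Set ν) :
    G.between S (U ∪ U') = G.between S U ∪ G.between S U' := by
  ext e
  constructor
  · rintro ⟨x, hx, y, hy | hy, he⟩
    · exact Or.inl ⟨x, hx, y, hy, he⟩
    · exact Or.inr ⟨x, hx, y, hy, he⟩
  · rintro (⟨x, hx, y, hy, he⟩ | ⟨x, hx, y, hy, he⟩)
    · exact ⟨x, hx, y, Or.inl hy, he⟩
    · exact ⟨x, hx, y, Or.inr hy, he⟩

lemma between_union_left (S S' U : Set ν) :
    G.between (S ∪ S') U = G.between S U ∪ G.between S' U := by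
  rw [between_comm, between_union_right, between_comm U S, between_comm U S']

lemma ncard_between_union_right_le (S U U' : Set ν) :
    (G.between S (U ∪ U')).ncard ≤ (G.between S U).ncard + (G.between S U').ncard := by
  rw [between_union_right]
  exact Set.ncard_union_le _ _

end Between

section Cliques

/-- Disjoint connected pairwise adjacent sets give a clique minor. -/
lemma clique_isMinorOf (hfin : V(G).Finite) (hE : E(G).Finite) (hl : G.Loopless)
    (hEne : E(G).Nonempty) {k : ℕ} (hk : 0 < k) (B : Fin k → Set ν) (hne : ∀ i, (B i).Nonempty) (hBV : ∀ i, B i ⊆ V(G))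
    (hconn : ∀ i, Conn G.Adj (B i)) (hdisj : ∀ i j, i ≠ j → Disjoint (B i) (B j))
    (hadj : ∀ i j, i ≠ j → ∃ x ∈ B i, ∃ y ∈ B j, G.Adj x y) : (clique k).IsMinorOf G := by
  have hHlink : ∀ (e : Sym2 (Fin k)) (x y : Fin k),
      (clique k).IsLink e x y ↔ e = s(x, y) ∧ x ≠ y := by
    intro e x y
    constructor
    · rintro ⟨rfl, h⟩
      exact ⟨rfl, by simpa using h⟩
    · rintro ⟨rfl, h⟩
      exact ⟨rfl, by simpa using h⟩
  have hex : ∀ e ∈ E(clique k), ∃ f, ∀ x y, (clique k).IsLink e x y →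
      ∃ a ∈ B x, ∃ b ∈ B y, G.IsLink f a b := by
    intro e he
    obtain ⟨x, y, h⟩ := exists_isLink_of_mem_edgeSet he
    obtain ⟨a, ha, b, hb, f, hf⟩ := hadj x y ((hHlink _ _ _).1 h).2
    refine ⟨f, fun x' y' h' => ?_⟩
    rcases h.eq_and_eq_or_eq_and_eq h' with ⟨rfl, rfl⟩ | ⟨rfl, rfl⟩
    · exact ⟨a, ha, b, hb, hf⟩
    · exact ⟨b, hb, a, ha, hf.symm⟩
  have huniq : ∀ i j x, x ∈ B i → x ∈ B j → i = j := by
    intro i j x hx hx'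
    by_contra h
    exact Set.disjoint_left.1 (hdisj i j h) hx hx'
  have : Nonempty ε := ⟨hEne.some⟩
  choose! η hη using hex
  refine isMinorOf_of_branchSets hfin hE hl (clique k) B
    ⟨fun e x h => ((hHlink _ _ _).1 h).2 rfl⟩ ⟨⟨0, hk⟩, trivial⟩ (fun v _ => hne v)
    (fun v _ => hBV v) (fun v _ => hconn v) (fun v _ w _ h => hdisj v w h) η ?_
    (fun e x y h => hη e h.edge_mem x y h)
  -- Branch sets are disjoint, so an edge of `G` determines the pair of branch sets that it joins.
  intro e he e' he' heq
  obtain ⟨x, y, h⟩ := exists_isLink_of_mem_edgeSet he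
  obtain ⟨x', y', h'⟩ := exists_isLink_of_mem_edgeSet he'
  obtain ⟨a, ha, b, hb, hf⟩ := hη e he x y h
  obtain ⟨a', ha', b', hb', hf'⟩ := hη e' he' x' y' h'
  rw [((hHlink _ _ _).1 h).1, ((hHlink _ _ _).1 h').1]
  rw [heq] at hf
  rcases hf.eq_and_eq_or_eq_and_eq hf' with ⟨rfl, rfl⟩ | ⟨rfl, rfl⟩
  · rw [huniq _ _ _ ha ha', huniq _ _ _ hb hb']
  · rw [huniq _ _ _ ha hb', huniq _ _ _ hb ha', Sym2.eq_swap]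

end Cliques

end Graph

/-! ### Girth and loose connectivity as statements about edge cuts. -/

namespace Graph

universe u v

variable {ν : Type u} {ε : Type v} {G : Graph ν ε}

/-- Two disjoint connected sets with few vertices have fewer than `r` edges between them. -/
def ThetaSparse (G : Graph ν ε) (r N : ℕ) : Prop :=
  ∀ S U : Set ν, S ⊆ V(G) → U ⊆ V(G) → Conn G.Adj S → Conn G.Adj U → Disjoint S U →
    S.ncard + U.ncard + r < N + 2 → (G.between S U).ncard < r

/-- A connected set is connected by fewer edges than it has vertices. -/
lemma Conn.exists_restrict {S : Set ν} (hS : Conn G.Adj S) (hfin : S.Finite) (hne : S.Nonempty) :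
    ∃ F : Set ε, F.Finite ∧ F ⊆ E(G) ∧ F.ncard + 1 ≤ S.ncard ∧ Conn (G.restrict F).Adj S := by
  have hPfin : {D | D ⊆ S ∧ D.Nonempty ∧ ∃ F : Set ε, F.Finite ∧ F ⊆ E(G) ∧
      F.ncard + 1 ≤ D.ncard ∧ Conn (G.restrict F).Adj D}.Finite :=
    hfin.finite_subsets.subset fun X hX => hX.1
  obtain ⟨x, hx⟩ := hne
  obtain ⟨D, ⟨hDS, hDne, F, hF, hFE, hcard, hD⟩, hmax⟩ := hPfin.exists_maximal
    ⟨{x}, by simpa using hx, ⟨x, rfl⟩, ∅, Set.finite_empty, Set.empty_subset _, by simp,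
      conn_singleton x⟩
  by_cases hDeq : D = S
  · subst hDeq
    exact ⟨F, hF, hFE, hcard, hD⟩
  exfalso
  obtain ⟨y, hyS, hyD⟩ := Set.exists_of_ssubset (hDS.ssubset_of_ne hDeq)
  obtain ⟨t, ht⟩ := hDne
  obtain ⟨a, -, haD, b, hbS, hbD, e, he⟩ := hS.exists_adj ⟨t, hDS ht, ht⟩ hyS hyD
  refine hbD (hmax ⟨Set.insert_subset hbS hDS, ⟨t, Set.mem_insert_of_mem _ ht⟩, insert e F,
    hF.insert e, Set.insert_subset he.edge_mem hFE, ?_, ?_⟩ (Set.subset_insert _ _)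
    (Set.mem_insert _ _))
  · rw [Set.ncard_insert_of_notMem hbD (hfin.subset hDS)]
    have := Set.ncard_insert_le e F
    lia
  · have h1 : Conn (G.restrict (insert e F)).Adj D := hD.mono fun x _ y _ ⟨f, hf⟩ =>
      ⟨f, by simp only [restrict_isLink] at hf ⊢; exact ⟨Set.mem_insert_of_mem _ hf.1, hf.2⟩⟩
    refine h1.insert_of_adj (adj_symm _) haD ⟨e, ?_⟩
    simp only [restrict_isLink]
    exact ⟨Set.mem_insert _ _, he⟩

lemma theta_isMinorOf (hfin : V(G).Finite) (hE : E(G).Finite) (hl : G.Loopless) {r : ℕ}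
    {S U : Set ν} (hSV : S ⊆ V(G)) (hUV : U ⊆ V(G)) (hSne : S.Nonempty) (hUne : U.Nonempty)
    (hS : Conn G.Adj S) (hU : Conn G.Adj U) (hSU : Disjoint S U) (η : Fin r → ε)
    (hη : Function.Injective η) (hlink : ∀ i, η i ∈ G.between S U) :
    (theta r).IsMinorOf G := by
  have hlk : ∀ (e : Fin r) (x y : Fin 2),
      (theta r).IsLink e x y ↔ (x = 0 ∧ y = 1) ∨ (x = 1 ∧ y = 0) := by
    intro e x y
    simp [theta]
  refine isMinorOf_of_branchSets hfin hE hl (theta r) ![S, U] ⟨fun e x h => ?_⟩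
    ⟨0, Or.inl rfl⟩ ?_ ?_ ?_ ?_ η hη.injOn ?_
  · have := (hlk e x x).1 h
    rcases this with ⟨h1, h2⟩ | ⟨h1, h2⟩ <;> rw [h1] at h2 <;> exact absurd h2 (by decide)
  · intro v _; fin_cases v <;> assumption
  · intro v _; fin_cases v <;> assumption
  · intro v _; fin_cases v <;> assumption
  · intro v _ w _ h
    fin_cases v <;> fin_cases w
    · exact absurd rfl h
    · exact hSU
    · exact hSU.symm
    · exact absurd rfl h
  · intro e x y h
    obtain ⟨a, ha, b, hb, he⟩ := hlink e
    rcases (hlk e x y).1 h with ⟨rfl, rfl⟩ | ⟨rfl, rfl⟩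
    · exact ⟨a, ha, b, hb, he⟩
    · exact ⟨b, hb, a, ha, he.symm⟩

/-- Spanning trees of `S` and `U` and `r` edges between them form a model with at most
$(|S|-1)+(|U|-1)+r$ edges, whence the `N + 2` in `ThetaSparse`. -/
lemma thetaSparse_of_le_minorGirth (hfin : V(G).Finite) (hE : E(G).Finite) (hl : G.Loopless)
    {r N : ℕ} (hr : 0 < r) (hg : (N : ℕ∞) ≤ minorGirth (theta r) G) : ThetaSparse G r N := by
  intro S U hSV hUV hS hU hSU hcard
  by_contra! hrc
  obtain ⟨e, x, hx, y, hy, -⟩ : (G.between S U).Nonempty :=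
    Set.nonempty_of_ncard_ne_zero (by lia)
  obtain ⟨R, hRsub, hRcard⟩ := Set.exists_subset_card_eq hrc
  have hRfin : R.Finite := hE.subset (hRsub.trans (between_subset _ _))
  obtain ⟨F, hF, hFE, hFc, hFS⟩ := hS.exists_restrict (hfin.subset hSV) ⟨x, hx⟩
  obtain ⟨F', hF', hFE', hFc', hFU⟩ := hU.exists_restrict (hfin.subset hUV) ⟨y, hy⟩
  let M := G.restrict (F ∪ F' ∪ R)
  have hMG : M ≤ G := restrict_le
  have hFR : ∀ Q ⊆ F ∪ F' ∪ R, ∀ a b, (G.restrict Q).Adj a b → M.Adj a b := by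
    rintro Q hQ a b ⟨f, hf⟩
    refine ⟨f, ?_⟩
    simp only [M, restrict_isLink] at hf ⊢
    exact ⟨hQ hf.1, hf.2⟩
  have hMc : E(M).ncard ≤ F.ncard + F'.ncard + R.ncard := by
    have h1 : E(M) ⊆ F ∪ F' ∪ R := by
      intro f hf
      simp only [M, edgeSet_restrict] at hf
      exact hf.2
    refine (Set.ncard_le_ncard h1 ((hF.union hF').union hRfin)).trans ?_
    have := Set.ncard_union_le (F ∪ F') R
    have := Set.ncard_union_le F F'
    lia
  have hMfin : E(M).Finite := hE.subset hMG.edgeSet_mono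
  have hRc : Fintype.card (Fin r) = Nat.card R := by
    rw [Fintype.card_fin, ← hRcard]; rfl
  have : Finite R := hRfin
  have := Fintype.ofFinite R
  rw [Nat.card_eq_fintype_card] at hRc
  let σ := Fintype.equivOfCardEq hRc
  have hmodel : M.IsModelIn (theta r) G := by
    refine ⟨hMG, theta_isMinorOf (hfin.subset hMG.vertexSet_mono) hMfin
      (Loopless.anti hMG) (S := S) (U := U) hSV hUV ⟨x, hx⟩ ⟨y, hy⟩ ?_ ?_ hSU
      (fun i => (σ i : ε)) (fun i j h => σ.injective (Subtype.ext h)) ?_⟩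
    · exact hFS.mono fun a _ b _ h => hFR F (fun f hf => Or.inl (Or.inl hf)) a b h
    · exact hFU.mono fun a _ b _ h => hFR F' (fun f hf => Or.inl (Or.inr hf)) a b h
    · intro i
      obtain ⟨a, ha, b, hb, h⟩ := hRsub (σ i).2
      refine ⟨a, ha, b, hb, ?_⟩
      simp only [M, restrict_isLink]
      exact ⟨Or.inr (σ i).2, h⟩
  have h1 : (N : ℕ∞) ≤ E(M).encard := hg.trans (iInf₂_le M hmodel)
  rw [← hMfin.cast_ncard_eq] at h1
  have h2 : N ≤ E(M).ncard := by exact_mod_cast h1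
  lia

/-- An edge cut with few edges and more than `α` vertices on both sides contradicts loose
connectivity. -/
lemma LooselyConnected.false_of_cut (hE : E(G).Finite)
    {α β : ℕ} (hG : G.LooselyConnected α β) {S : Set ν} (hSV : S ⊆ V(G))
    (h1 : α < S.ncard) (h2 : α < (V(G) \ S).ncard)
    (hcut : (G.between S (V(G) \ S)).ncard < β) (hn : β + 2 * α < V(G).ncard) : False := by
  -- The edge cut becomes the vertex separation `(S ∪ N, V(G) \ X)` with left side `X`. Vertices of
  -- `S` that meet no cut edge must lie in `X`, because those of `S \ X` are to be charged to cut
  -- edges.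
  let I : Set ν := {s | s ∈ S ∧ ∀ y ∈ V(G) \ S, ¬ G.Adj s y}
  have hIS : I ⊆ S := fun s hs => hs.1
  obtain ⟨X, hIX, hXS, hX⟩ : ∃ X, I ⊆ X ∧ X ⊆ S ∧ ((X = I ∧ α < X.ncard) ∨ X.ncard = α + 1) := by
    by_cases hI : α < I.ncard
    · exact ⟨I, subset_rfl, hIS, Or.inl ⟨rfl, hI⟩⟩
    · obtain ⟨X, hIX, hXS, hX⟩ := Set.exists_subsuperset_card_eq hIS (n := α + 1) (by lia) (by lia)
      exact ⟨X, hIX, hXS, Or.inr hX⟩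
  let N : Set ν := {y | y ∈ V(G) \ S ∧ ∃ x ∈ X, G.Adj x y}
  have hNV : N ⊆ V(G) := fun y hy => hy.1.1
  have hU : (S ∪ N) ∪ (V(G) \ X) = V(G) := by
    ext x
    have := @hSV x
    have := @hNV x
    have := @hXS x
    simp only [Set.mem_union, Set.mem_sdiff]
    tauto
  have hAB : (S ∪ N) \ (V(G) \ X) = X := by
    ext x
    have := @hSV x
    have := @hXS x
    have : x ∈ N → x ∈ V(G) \ S := fun h => h.1
    simp only [Set.mem_union, Set.mem_sdiff] at *
    tauto
  have hBA : (V(G) \ X) \ (S ∪ N) = (V(G) \ S) \ N := by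
    ext x
    have := @hXS x
    simp only [Set.mem_union, Set.mem_sdiff] at *
    tauto
  have hcap : (S ∪ N) ∩ (V(G) \ X) = (S \ X) ∪ N := by
    ext x
    have := @hSV x
    have := @hXS x
    have : x ∈ N → x ∈ V(G) \ S := fun h => h.1
    simp only [Set.mem_union, Set.mem_sdiff, Set.mem_inter_iff] at *
    tauto
  -- Each vertex of the separator is charged to a cut edge of which it is an end: the edge starts
  -- outside `X` for a vertex of `S \ X`, and in `X` for a vertex of `N`. So the edge determines the
  -- vertex.
  have hcard : ((S \ X) ∪ N).ncard ≤ (G.between S (V(G) \ S)).ncard := by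
    have hex : ∀ y ∈ (S \ X) ∪ N, ∃ e a b, G.IsLink e a b ∧ a ∈ S ∧ b ∈ V(G) \ S ∧
        ((a ∉ X ∧ y = a) ∨ (a ∈ X ∧ y = b)) := by
      rintro y (⟨hyS, hyX⟩ | ⟨hyV, x, hx, e, he⟩)
      · have : y ∉ I := fun h => hyX (hIX h)
        simp only [I, Set.mem_ofPred_eq, not_and, not_forall, not_not] at this
        obtain ⟨b, hb, e, he⟩ := this hyS
        exact ⟨e, y, b, he, hyS, hb, Or.inl ⟨hyX, rfl⟩⟩
      · exact ⟨e, x, y, he, hXS hx, hyV, Or.inr ⟨hx, rfl⟩⟩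
    have hfin' : (G.between S (V(G) \ S)).Finite := hE.subset (between_subset _ _)
    by_cases hemp : (S \ X) ∪ N = ∅
    · simp [hemp]
    obtain ⟨y₀, hy₀⟩ := Set.nonempty_iff_ne_empty.2 hemp
    obtain ⟨e₀, -⟩ := hex y₀ hy₀
    have : Nonempty ε := ⟨e₀⟩
    choose! f hf using hex
    refine Set.ncard_le_ncard_of_injOn f ?_ ?_ hfin'
    · intro y hy
      obtain ⟨a, b, h, ha, hb, -⟩ := hf y hy
      exact ⟨a, ha, b, hb, h⟩
    · intro y hy y' hy' heq
      obtain ⟨a, b, h, ha, hb, h'⟩ := hf y hy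
      obtain ⟨a', b', k, ha', hb', k'⟩ := hf y' hy'
      rw [heq] at h
      rcases h.eq_and_eq_or_eq_and_eq k with ⟨rfl, rfl⟩ | ⟨rfl, rfl⟩
      · grind
      · exact absurd ha hb'.2
  have hnadj : ∀ x ∈ (S ∪ N) \ (V(G) \ X), ∀ y ∈ (V(G) \ X) \ (S ∪ N), ¬ G.Adj x y := by
    rw [hAB, hBA]
    intro x hx y hy hxy
    exact hy.2 ⟨hy.1, x, hx, hxy⟩
  have hfinal := hG _ _ hU hnadj (by rw [hcap]; lia)
  rw [hAB, hBA] at hfinal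
  -- If `X = I`, no cut edge meets `X`, so `N` is empty and the right side is `V(G) \ S`. Otherwise
  -- $|X|=\alpha+1$, the right side is the small one, and $|V(G)|\le(\alpha+1)+(\beta-1)+\alpha$.
  rcases hX with ⟨rfl, hX⟩ | hX
  · have : N = ∅ := by
      ext y
      simp only [Set.mem_empty_iff_false, iff_false]
      rintro ⟨hy, x, hx, hxy⟩
      exact hx.2 y hy hxy
    rw [this, Set.sdiff_empty] at hfinal
    rcases min_le_iff.1 hfinal with h | h <;> lia
  · have h3 : V(G) = X ∪ (((S \ X) ∪ N) ∪ ((V(G) \ S) \ N)) := by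
      ext x
      have := @hSV x
      have := @hXS x
      have := @hNV x
      simp only [Set.mem_union, Set.mem_sdiff]
      tauto
    have h4 := Set.ncard_union_le X (((S \ X) ∪ N) ∪ ((V(G) \ S) \ N))
    have h5 := Set.ncard_union_le ((S \ X) ∪ N) ((V(G) \ S) \ N)
    rw [← h3] at h4
    rcases min_le_iff.1 hfinal with h | h <;> lia

/-- Deleting fewer than `β` vertices leaves no balanced union of components. -/
lemma LooselyConnected.ncard_le_or {α β : ℕ} (hG : G.LooselyConnected α β) {S X : Set ν} (hSV : S ⊆ V(G))
    (hS : (V(G) \ S).ncard < β) (hXS : X ⊆ S) (hX : ClosedIn G.Adj S X) :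
    X.ncard ≤ α ∨ (S \ X).ncard ≤ α := by
  have h := hG (V(G) \ (S \ X)) (V(G) \ X) ?_ ?_ ?_
  · have h1 : (V(G) \ (S \ X)) \ (V(G) \ X) = X := by
      ext x
      have := @hSV x
      have := @hXS x
      simp only [Set.mem_sdiff]
      tauto
    have h2 : (V(G) \ X) \ (V(G) \ (S \ X)) = S \ X := by
      ext x
      have := @hSV x
      have := @hXS x
      simp only [Set.mem_sdiff]
      tauto
    rw [h1, h2] at h
    exact min_le_iff.1 h
  · ext x
    simp only [Set.mem_sdiff, Set.mem_union]
    tauto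
  · intro x hx y hy hxy
    have h1 : x ∈ X := by
      simp only [Set.mem_sdiff] at hx
      tauto
    have h2 : y ∈ S ∧ y ∉ X := by
      simp only [Set.mem_sdiff] at hy
      tauto
    exact h2.2 (hX x h1 y h2.1 hxy)
  · convert hS using 2
    ext x
    have := @hSV x
    have := @hXS x
    simp only [Set.mem_sdiff, Set.mem_inter_iff]
    tauto

end Graph

/-! ### A lower bound for the number of vertices. -/

namespace Graph

universe u v

variable {ν : Type u} {ε : Type v} {G : Graph ν ε} {r N α β : ℕ}

/-- Any two disjoint connected sets have fewer than `r` edges between them. -/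
def NoTheta (G : Graph ν ε) (r : ℕ) : Prop :=
  ∀ S U : Set ν, S ⊆ V(G) → U ⊆ V(G) → Conn G.Adj S → Conn G.Adj U → Disjoint S U →
    (G.between S U).ncard < r

lemma ThetaSparse.noTheta (h : ThetaSparse G r N) (hfin : V(G).Finite)
    (hn : V(G).ncard + r < N + 2) : NoTheta G r := by
  intro S U hS hU hSc hUc hSU
  refine h S U hS hU hSc hUc hSU ?_
  have h1 := Set.ncard_union_eq hSU (hfin.subset hS) (hfin.subset hU)
  have h2 := Set.ncard_le_ncard (Set.union_subset hS hU) hfin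
  lia

/-- In a component of `W` take `w` with connected remainder: all edges from `w` into `W` end in that
remainder. Hence `G` is $(r-1)$-degenerate, which bounds its number of edges. -/
lemma NoTheta.exists_ncard_between_lt (h : NoTheta G r) (hfin : V(G).Finite) (hE : E(G).Finite)
    {W : Set ν} (hW : W ⊆ V(G)) (hne : W.Nonempty) :
    ∃ w ∈ W, (G.between {w} (W \ {w})).ncard < r := by
  obtain ⟨x, hx⟩ := hne
  obtain ⟨C, hCW, hxC, hC, hcl⟩ := exists_component (adj_symm G) hx
  obtain ⟨w, D, hwD, rfl, hD⟩ := hC.exists_eq_insert (adj_symm G) ((hfin.subset hW).subset hCW)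
    ⟨x, hxC⟩
  have hwW : w ∈ W := hCW (Set.mem_insert _ _)
  refine ⟨w, hwW, lt_of_le_of_lt ?_ (h {w} D (by simpa using hW hwW)
    ((Set.subset_insert _ _).trans (hCW.trans hW)) (conn_singleton w) hD
    (Set.disjoint_singleton_left.2 hwD))⟩
  refine Set.ncard_le_ncard ?_ (hE.subset (between_subset _ _))
  rintro e ⟨_, rfl, y, ⟨hyW, hyw⟩, he⟩
  refine ⟨_, rfl, y, ?_, he⟩
  exact (hcl _ (Set.mem_insert _ _) y hyW ⟨e, he⟩).resolve_left hyw

lemma between_self_subset (hl : G.Loopless) (w : ν) (W : Set ν) :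
    G.between (insert w W) (insert w W) ⊆ G.between W W ∪ G.between {w} W := by
  rintro e ⟨x, rfl | hx, y, rfl | hy, he⟩
  · exact absurd rfl he.ne
  · exact Or.inr ⟨x, rfl, y, hy, he⟩
  · exact Or.inr ⟨y, rfl, x, hx, he.symm⟩
  · exact Or.inl ⟨x, hx, y, hy, he⟩

lemma NoTheta.ncard_between_self_le (h : NoTheta G r) (hfin : V(G).Finite) (hE : E(G).Finite)
    (hl : G.Loopless) (m : ℕ) :
    ∀ W : Set ν, W ⊆ V(G) → W.ncard = m → (G.between W W).ncard ≤ (r - 1) * m := by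
  induction m with
  | zero =>
    intro W hW hm
    have : W = ∅ := (Set.ncard_eq_zero (hfin.subset hW)).1 hm
    simp [this, between]
  | succ m ih =>
    intro W hW hm
    obtain ⟨w, hw, hlt⟩ := h.exists_ncard_between_lt hfin hE hW
      (Set.nonempty_of_ncard_ne_zero (by lia))
    have h1 := ih (W \ {w}) (Set.sdiff_subset.trans hW)
      (by rw [Set.ncard_sdiff_singleton_of_mem hw]; lia)
    have h2 := between_self_subset hl w (W \ {w})
    rw [Set.insert_sdiff_singleton, Set.insert_eq_of_mem hw] at h2
    have h3 := Set.ncard_le_ncard h2 ((hE.subset (between_subset _ _)).union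
      (hE.subset (between_subset _ _)))
    have h4 := Set.ncard_union_le (G.between (W \ {w}) (W \ {w})) (G.between {w} (W \ {w}))
    rw [Nat.mul_succ]
    lia

lemma NoTheta.ncard_between_le (h : NoTheta G r) {L T : Set ν} (hL : L.Finite) (hLV : L ⊆ V(G))
    (hTV : T ⊆ V(G)) (hT : Conn G.Adj T) (hLT : Disjoint L T) :
    (G.between L T).ncard ≤ (r - 1) * L.ncard := by
  induction L, hL using Set.Finite.induction_on with
  | empty => simp [between]
  | @insert a s ha hs ih =>
    rw [Set.insert_subset_iff] at hLV
    rw [Set.disjoint_insert_left] at hLT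
    have h1 := ih hLV.2 hLT.2
    have h2 := h {a} T (by simpa using hLV.1) hTV (conn_singleton a) hT
      (Set.disjoint_singleton_left.2 hLT.1)
    rw [Set.ncard_insert_of_notMem ha hs, Set.insert_eq, between_union_left]
    have h3 := Set.ncard_union_le (G.between {a} T) (G.between s T)
    rw [Nat.mul_succ]
    lia

/-- Some bipartition is crossed by at least half of the edges. -/
lemma exists_half_cut (hE : E(G).Finite) (hl : G.Loopless) {W : Set ν} (hW : W.Finite) :
    ∃ S T, S ∪ T = W ∧ Disjoint S T ∧
      (G.between W W).ncard ≤ 2 * (G.between S T).ncard := by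
  induction W, hW using Set.Finite.induction_on with
  | empty => exact ⟨∅, ∅, by simp, by simp, by simp [between]⟩
  | @insert w W hw hW ih =>
    obtain ⟨S, T, rfl, hST, hc⟩ := ih
    -- The new vertex joins the part to which it sends at most half of its edges.
    wlog hle : (G.between {w} S).ncard ≤ (G.between {w} T).ncard generalizing S T
    · rw [Set.union_comm] at hw hW hc ⊢
      rw [between_comm S T] at hc
      exact this T S hw hW hST.symm hc (by lia)
    refine ⟨insert w S, T, Set.insert_union, ?_, ?_⟩
    · rw [Set.disjoint_insert_left]
      exact ⟨fun h => hw (Or.inr h), hST⟩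
    have hf : ∀ A B : Set ν, (G.between A B).Finite := fun A B => hE.subset (between_subset _ _)
    have h1 := Set.ncard_le_ncard (between_self_subset hl w (S ∪ T)) ((hf _ _).union (hf _ _))
    have h2 := Set.ncard_union_le (G.between (S ∪ T) (S ∪ T)) (G.between {w} (S ∪ T))
    have h3 := ncard_between_union_right_le (G := G) {w} S T
    have h4 : (G.between (insert w S) T).ncard =
        (G.between {w} T).ncard + (G.between S T).ncard := by
      rw [Set.insert_eq, between_union_left]
      refine Set.ncard_union_eq ?_ (hf _ _) (hf _ _)
      rw [Set.disjoint_left]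
      rintro e ⟨_, rfl, y, hy, he⟩ ⟨s, hs, t, ht, he'⟩
      rcases he.left_eq_or_eq he' with rfl | rfl
      · exact hw (Or.inl hs)
      · exact hw (Or.inr ht)
    lia

/-- A loosely connected graph with few vertices and no theta graph has few edges. -/
lemma NoTheta.ncard_edgeSet_le (h : NoTheta G r) (hfin : V(G).Finite) (hE : E(G).Finite)
    (hl : G.Loopless) (hr : 0 < r) (hG : G.LooselyConnected α β)
    (hn : V(G).ncard ≤ β + 2 * α) : E(G).ncard ≤ 2 * ((r - 1) * (1 + 24 * α)) := by
  -- If `S` had two complementary closed parts with more than `2 * α` vertices each, fewer than `β`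
  -- vertices would lie outside `S`, against loose connectivity. So `S` is connected up to few
  -- vertices or is itself small.
  have key : ∀ S ⊆ V(G), ∃ D ⊆ S, Conn G.Adj D ∧ (S \ D).ncard ≤ 6 * α := by
    intro S hS
    by_cases hc : 3 * (2 * α) < S.ncard
    · obtain ⟨D, hDS, hD, -, hDc⟩ := exists_giant (adj_symm G) (hfin.subset hS) (a := 2 * α) (by
        intro X hX hcl
        by_contra! hcon
        have h1 := Set.ncard_sdiff_add_ncard_of_subset hX (hfin.subset hS)
        have h2 := Set.ncard_sdiff_add_ncard_of_subset hS hfin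
        have := hG.ncard_le_or hS (by lia) hX hcl
        lia) hc
      exact ⟨D, hDS, hD, by lia⟩
    · exact ⟨∅, Set.empty_subset _, conn_empty, by simpa using (by lia : S.ncard ≤ 6 * α)⟩
  obtain ⟨S, T, hSTV, hST, hcut⟩ := exists_half_cut hE hl hfin
  have hSV : S ⊆ V(G) := hSTV ▸ Set.subset_union_left
  have hTV : T ⊆ V(G) := hSTV ▸ Set.subset_union_right
  obtain ⟨D, hDS, hD, hDc⟩ := key S hSV
  obtain ⟨D', hDT, hD', hDc'⟩ := key T hTV
  rw [between_vertexSet] at hcut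
  have h1 := h D D' (hDS.trans hSV) (hDT.trans hTV) hD hD' (hST.mono hDS hDT)
  have h2 := h.ncard_between_le ((hfin.subset hSV).subset (Set.sdiff_subset (s := S) (t := D)))
    (Set.sdiff_subset.trans hSV) (hDT.trans hTV) hD' (hST.mono Set.sdiff_subset hDT)
  have h3 := h.ncard_between_le ((hfin.subset hTV).subset (Set.sdiff_subset (s := T) (t := D')))
    (Set.sdiff_subset.trans hTV) (hDS.trans hSV) hD (hST.symm.mono Set.sdiff_subset hDS)
  have h4 := h.ncard_between_self_le hfin hE hl _ ((S \ D) ∪ (T \ D'))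
    (Set.union_subset (Set.sdiff_subset.trans hSV) (Set.sdiff_subset.trans hTV)) rfl
  have h5 := Set.ncard_union_le (S \ D) (T \ D')
  -- In units of $r-1$ the four terms contribute at most $1$, $6\alpha$, $6\alpha$ and, by
  -- degeneracy, $12\alpha$ edges.
  have h6 : G.between S T ⊆ G.between D D' ∪ (G.between (S \ D) D' ∪ (G.between (T \ D') D ∪
      G.between ((S \ D) ∪ (T \ D')) ((S \ D) ∪ (T \ D')))) := by
    rintro e ⟨x, hx, y, hy, he⟩
    by_cases hxD : x ∈ D <;> by_cases hyD : y ∈ D'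
    · exact Or.inl ⟨x, hxD, y, hyD, he⟩
    · exact Or.inr (Or.inr (Or.inl ⟨y, ⟨hy, hyD⟩, x, hxD, he.symm⟩))
    · exact Or.inr (Or.inl ⟨x, ⟨hx, hxD⟩, y, hyD, he⟩)
    · exact Or.inr (Or.inr (Or.inr ⟨x, Or.inl ⟨hx, hxD⟩, y, Or.inr ⟨hy, hyD⟩, he⟩))
  have hf : ∀ A B : Set ν, (G.between A B).Finite := fun A B => hE.subset (between_subset _ _)
  have h7 := Set.ncard_le_ncard h6 ((hf _ _).union ((hf _ _).union ((hf _ _).union (hf _ _))))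
  have h8 := Set.ncard_union_le (G.between D D') (G.between (S \ D) D' ∪ (G.between (T \ D') D ∪
      G.between ((S \ D) ∪ (T \ D')) ((S \ D) ∪ (T \ D'))))
  have h9 := Set.ncard_union_le (G.between (S \ D) D') (G.between (T \ D') D ∪
      G.between ((S \ D) ∪ (T \ D')) ((S \ D) ∪ (T \ D')))
  have h10 := Set.ncard_union_le (G.between (T \ D') D)
      (G.between ((S \ D) ∪ (T \ D')) ((S \ D) ∪ (T \ D')))
  have m1 := Nat.mul_le_mul_left (r - 1) hDc
  have m2 := Nat.mul_le_mul_left (r - 1) hDc'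
  have m3 := Nat.mul_le_mul_left (r - 1) h5
  rw [Nat.mul_add] at m3
  have m4 : (r - 1) * (1 + 24 * α) = (r - 1) + 4 * ((r - 1) * (6 * α)) := by ring
  lia

/-- Removing a connected piece of `U` minus a vertex leaves `U` connected. -/
lemma Conn.sdiff_of_closedIn {A : ν → ν → Prop} (hA : ∀ x y, A x y → A y x) {U C : Set ν}
    (hU : Conn A U) {u : ν} (hu : u ∈ U) (hC : C ⊆ U \ {u}) (hcl : ClosedIn A (U \ {u}) C) :
    Conn A (U \ C) := by
  intro Y hY hYcl
  by_cases huY : u ∈ Y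
  · have h1 : U ⊆ Y ∪ C := by
      refine hU _ ⟨u, hu, Or.inl huY⟩ ?_
      intro x hx hxY y hy hxy
      by_cases hyC : y ∈ C
      · exact Or.inr hyC
      by_cases hxC : x ∈ C
      · by_cases hyu : y = u
        · subst hyu; exact Or.inl huY
        · exact Or.inr (hcl x hxC y ⟨hy, hyu⟩ hxy)
      · exact Or.inl (hYcl x ⟨hx, hxC⟩ (hxY.resolve_right hxC) y ⟨hy, hyC⟩ hxy)
    exact fun x hx => (h1 hx.1).resolve_right hx.2
  · exfalso
    obtain ⟨t, ht, htY⟩ := hY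
    have h1 : U ⊆ Y ∩ (U \ C) := by
      refine hU _ ⟨t, ht.1, htY, ht⟩ ?_
      rintro x hx ⟨hxY, hxC⟩ y hy hxy
      have hyC : y ∉ C := fun hyC =>
        hxC.2 (hcl y hyC x ⟨hx, fun h => huY (h ▸ hxY)⟩ (hA _ _ hxy))
      exact ⟨hYcl x hxC hxY y ⟨hy, hyC⟩ hxy, hy, hyC⟩
    exact huY (h1 hu).1

/-- A large loosely connected graph has a bipartition into two connected parts that are not
small. -/
lemma LooselyConnected.exists_conn_bipartition (hfin : V(G).Finite) (hconn : Conn G.Adj V(G))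
    (hG : G.LooselyConnected α β) (hβ : 2 ≤ β) (hn : 4 * α + 4 ≤ V(G).ncard) :
    ∃ S ⊆ V(G), Conn G.Adj S ∧ Conn G.Adj (V(G) \ S) ∧ α < S.ncard ∧ α < (V(G) \ S).ncard := by
  have hA := adj_symm G
  have hPfin : {S | S ⊆ V(G) ∧ S.Nonempty ∧ Conn G.Adj S ∧ Conn G.Adj (V(G) \ S) ∧
      S.ncard ≤ (V(G) \ S).ncard}.Finite := hfin.finite_subsets.subset fun X hX => hX.1
  obtain ⟨w, D, hwD, hVD, hD⟩ := hconn.exists_eq_insert hA hfin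
    (Set.nonempty_of_ncard_ne_zero (by lia))
  have hVw : V(G) \ {w} = D := by rw [hVD]; simp [hwD]
  have hwV : w ∈ V(G) := hVD ▸ Set.mem_insert _ _
  -- `S` is a largest connected set with connected complement containing at most half of the
  -- vertices; suppose that it has at most `α`.
  obtain ⟨S, ⟨hSV, hSne, hS, hU, hle⟩, hmax⟩ := Set.exists_max_image _ Set.ncard hPfin
    ⟨{w}, by simpa using hwV, ⟨w, rfl⟩, conn_singleton w, hVw ▸ hD, by
      rw [Set.ncard_sdiff_singleton_of_mem hwV, Set.ncard_singleton]; lia⟩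
  refine ⟨S, hSV, hS, hU, ?_⟩
  have hsum := Set.ncard_sdiff_add_ncard_of_subset hSV hfin
  by_contra hcon
  have hSα : S.ncard ≤ α := by lia
  set U := V(G) \ S with hUdef
  have hUV : U ⊆ V(G) := Set.sdiff_subset
  -- A component `C` of `U - u` has a connected complement, so the smaller of the two competes with
  -- `S`. It is not the complement, which properly contains `S`; hence $|C|\le|S|\le\alpha$.
  have hsmall : ∀ s ∈ S, ∀ u ∈ U, G.Adj s u → ∀ C ⊆ U \ {u}, C.Nonempty → Conn G.Adj C →
      ClosedIn G.Adj (U \ {u}) C → C.ncard ≤ α := by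
    intro s hs u hu hsu C hCU hCne hC hcl
    have hCV : C ⊆ V(G) := hCU.trans (Set.sdiff_subset.trans hUV)
    have h1 := hU.sdiff_of_closedIn hA hu hCU hcl
    have huC : u ∉ C := fun h => (hCU h).2 rfl
    have h2 : Conn G.Adj (V(G) \ C) := by
      have : V(G) \ C = S ∪ (U \ C) := by
        ext x
        have h1 := @hSV x
        have h2 := @hCU x
        simp only [hUdef, Set.mem_sdiff, Set.mem_union] at *
        tauto
      rw [this]
      exact hS.union_of_adj hA h1 hs ⟨hu, huC⟩ hsu
    by_cases hcmp : C.ncard ≤ (V(G) \ C).ncard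
    · have := hmax C ⟨hCV, hCne, hC, h2, hcmp⟩
      lia
    · exfalso
      have hCC : V(G) \ (V(G) \ C) = C := Set.sdiff_sdiff_cancel_left hCV
      have := hmax (V(G) \ C) ⟨Set.sdiff_subset, ⟨u, hUV hu, huC⟩, h2, by rw [hCC]; exact hC,
        by rw [hCC]; lia⟩
      have h3 : insert u S ⊆ V(G) \ C := by
        rintro x (rfl | hx)
        · exact ⟨hUV hu, huC⟩
        · exact ⟨hSV hx, fun h => (hCU h).1.2 hx⟩
      have h4 := Set.ncard_le_ncard h3 (hfin.subset Set.sdiff_subset)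
      rw [Set.ncard_insert_of_notMem hu.2 (hfin.subset hSV)] at h4
      lia
  obtain ⟨u₀, hu₀⟩ : U.Nonempty := Set.nonempty_of_ncard_ne_zero (by lia)
  obtain ⟨t, ht⟩ := hSne
  obtain ⟨s, -, hs, u, huV, huS, hsu⟩ := hconn.exists_adj ⟨t, hSV ht, ht⟩ hu₀.1 hu₀.2
  have huU : u ∈ U := ⟨huV, huS⟩
  have hVu : (V(G) \ {u}).ncard + 1 = V(G).ncard := by
    rw [Set.ncard_sdiff_singleton_of_mem huV]; lia
  obtain ⟨D, hDV, hD, hDcl, hDc⟩ := exists_giant hA (hfin.subset (Set.sdiff_subset (t := {u})))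
    (a := α) (fun X hX hcl => hG.ncard_le_or Set.sdiff_subset (by
      rw [Set.sdiff_sdiff_cancel_left (by simpa using huV), Set.ncard_singleton]; lia) hX hcl)
    (by lia)
  have hDc' := Set.ncard_sdiff_add_ncard_of_subset hDV (hfin.subset Set.sdiff_subset)
  -- If the giant component `D` of `G - u` meets `S`, it passes into `U` at some `u' ≠ u`. The
  -- component of `u'` in `U - u` and that of `u` in `U - u'` then cover `U`, so $|U|\le2\alpha$.
  -- Otherwise `D` lies in `U - u`, against `hsmall`.
  by_cases hDS : (D ∩ S).Nonempty
  · have hDU : ∃ y ∈ D, y ∉ S := by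
      by_contra! hcon
      have := Set.ncard_le_ncard (show D ⊆ S from hcon) (hfin.subset hSV)
      lia
    obtain ⟨y, hyD, hyS⟩ := hDU
    obtain ⟨s', hs'D, hs', u', hu'D, hu'S, hsu'⟩ := hD.exists_adj hDS hyD hyS
    have hu'U : u' ∈ U := ⟨(hDV hu'D).1, hu'S⟩
    have hne : u' ≠ u := (hDV hu'D).2
    obtain ⟨C, hCU, hu'C, hC, hCcl⟩ := exists_component hA (show u' ∈ U \ {u} from ⟨hu'U, hne⟩)
    obtain ⟨C', hCU', huC', hC', hCcl'⟩ :=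
      exists_component hA (show u ∈ U \ {u'} from ⟨huU, hne.symm⟩)
    have h1 := hsmall s hs u huU hsu C hCU ⟨_, hu'C⟩ hC hCcl
    have h2 := hsmall s' hs' u' hu'U hsu' C' hCU' ⟨_, huC'⟩ hC' hCcl'
    have h3 := hU.sdiff_of_closedIn hA huU hCU hCcl
    have h4 : U \ C ⊆ C' := by
      refine h3 _ ⟨u, ⟨huU, fun h => (hCU h).2 rfl⟩, huC'⟩ ?_
      intro x hx hxC y hy hxy
      exact hCcl' x hxC y ⟨hy.1, fun h => hy.2 (h ▸ hu'C)⟩ hxy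
    have h5 := Set.ncard_le_ncard h4 (hfin.subset (hCU'.trans (Set.sdiff_subset.trans hUV)))
    have h6 := Set.ncard_sdiff_add_ncard_of_subset (hCU.trans Set.sdiff_subset) (hfin.subset hUV)
    lia
  · have h1 : D ⊆ U \ {u} := fun x hx =>
      ⟨⟨(hDV hx).1, fun h => hDS ⟨x, hx, h⟩⟩, (hDV hx).2⟩
    have := hsmall s hs u huU hsu D h1 (Set.nonempty_of_ncard_ne_zero (by lia)) hD
      (fun x hx y hy hxy => hDcl x hx y ⟨hUV hy.1, hy.2⟩ hxy)
    lia

/-- A loosely connected graph with many edges and no short theta graph has many vertices. -/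
lemma ThetaSparse.le_ncard_vertexSet (hT : ThetaSparse G r N) (hfin : V(G).Finite)
    (hE : E(G).Finite) (hl : G.Loopless) (hconn : Conn G.Adj V(G)) (hr : 2 ≤ r) (hα : 1 ≤ α)
    (hG : G.LooselyConnected α (2 * r - 1)) (hN : 168 * α * r ≤ N) (hEN : N ≤ E(G).ncard) :
    N + 2 ≤ V(G).ncard + r ∧ 2 * r - 1 + 2 * α < V(G).ncard := by
  have hαr : α + r ≤ 2 * (α * r) := by nlinarith
  -- Otherwise there would be at most $50\alpha r$ edges, fewer than $168\alpha r$.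
  have hb : 2 * r - 1 + 2 * α < V(G).ncard := by
    by_contra! hc
    have h1 := (hT.noTheta hfin (by lia)).ncard_edgeSet_le hfin hE hl (by lia) hG hc
    have h2 : (r - 1) * (1 + 24 * α) ≤ r * (25 * α) := Nat.mul_le_mul (by lia) (by lia)
    have h3 : r * (25 * α) = 25 * (α * r) := by ring
    have h4 : 168 * α * r = 168 * (α * r) := by ring
    lia
  refine ⟨?_, hb⟩
  by_contra! hc
  -- Then $|E|\le(r-1)|V|$ forces many vertices, and a bipartition into two connected parts that are
  -- not small has fewer than `r` crossing edges.
  have hNT := hT.noTheta hfin hc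
  have h1 := hNT.ncard_between_self_le hfin hE hl _ V(G) subset_rfl rfl
  rw [between_vertexSet] at h1
  have h2 : 168 * α ≤ V(G).ncard := by
    have : r * (168 * α) ≤ r * V(G).ncard := by
      calc r * (168 * α) = 168 * α * r := by ring
        _ ≤ (r - 1) * V(G).ncard := by lia
        _ ≤ r * V(G).ncard := Nat.mul_le_mul_right _ (by lia)
    exact Nat.le_of_mul_le_mul_left this (by lia)
  obtain ⟨S, hSV, hS, hU, h3, h4⟩ := hG.exists_conn_bipartition hfin hconn (by lia) (by lia)
  have h5 := hNT S _ hSV Set.sdiff_subset hS hU Set.disjoint_sdiff_right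
  exact hG.false_of_cut hE hSV h3 h4 (by lia) hb

end Graph

/-! ### Sets of small radius and the breadth-first forest. -/

namespace Graph

universe u v

section Radius

variable {ν : Type u} {ε : Type v} {G : Graph ν ε} {A : ν → ν → Prop} {S U : Set ν} {h r N : ℕ}

/-- Some vertex of `S` can be joined inside `S` to every other one by a connected set with at most
`h + 1` vertices. -/
def HasRadius (A : ν → ν → Prop) (h : ℕ) (S : Set ν) : Prop :=
  ∃ t ∈ S, ∀ x ∈ S, ∃ D ⊆ S, Conn A D ∧ t ∈ D ∧ x ∈ D ∧ D.Finite ∧ D.ncard ≤ h + 1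

lemma HasRadius.conn (hS : HasRadius A h S) : Conn A S := by
  obtain ⟨t, -, ht⟩ := hS
  choose! D hDS hD htD hxD hfin hc using ht
  have : S = ⋃ x ∈ S, D x := by
    refine Set.Subset.antisymm (fun x hx => Set.mem_biUnion hx (hxD x hx)) ?_
    exact Set.iUnion₂_subset hDS
  rw [this]
  exact conn_biUnion hD htD

lemma ncard_biUnion_le_mul {ι : Type v} {R : Set ι} (hR : R.Finite) {D : ι → Set ν} {m : ℕ}
    (hD : ∀ i ∈ R, (D i).ncard ≤ m) : (⋃ i ∈ R, D i).ncard ≤ R.ncard * m := by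
  induction R, hR using Set.Finite.induction_on with
  | empty => simp
  | @insert a s ha hs ih =>
    rw [Set.biUnion_insert, Set.ncard_insert_of_notMem ha hs, Nat.succ_mul]
    have h1 := Set.ncard_union_le (D a) (⋃ i ∈ s, D i)
    have h2 := ih fun i hi => hD i (Set.mem_insert_of_mem _ hi)
    have h3 := hD a (Set.mem_insert _ _)
    lia

/-- Given `r` edges, only short connections from the two centres to their ends are needed, at most
`r * (h + 1)` vertices on each side. So the radius, not the size, has to be small. -/
lemma ThetaSparse.ncard_between_lt (hT : ThetaSparse G r N) (hE : E(G).Finite)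
    (hSV : S ⊆ V(G)) (hUV : U ⊆ V(G)) (hS : HasRadius G.Adj h S) (hU : HasRadius G.Adj h U)
    (hSU : Disjoint S U) (hN : 2 * (r * (h + 1)) + r < N + 2) : (G.between S U).ncard < r := by
  by_contra! hrc
  obtain ⟨R, hRsub, hRcard⟩ := Set.exists_subset_card_eq hrc
  have hRfin : R.Finite := hE.subset (hRsub.trans (between_subset _ _))
  obtain ⟨t, htS, ht⟩ := hS
  obtain ⟨t', htU, ht'⟩ := hU
  have hex : ∀ e ∈ R, ∃ D D', (D ⊆ S ∧ Conn G.Adj D ∧ t ∈ D ∧ D.ncard ≤ h + 1) ∧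
      (D' ⊆ U ∧ Conn G.Adj D' ∧ t' ∈ D' ∧ D'.ncard ≤ h + 1) ∧ e ∈ G.between D D' := by
    intro e he
    obtain ⟨x, hx, y, hy, hxy⟩ := hRsub he
    obtain ⟨D, hDS, hD, htD, hxD, -, hDc⟩ := ht x hx
    obtain ⟨D', hDS', hD', htD', hyD', -, hDc'⟩ := ht' y hy
    exact ⟨D, D', ⟨hDS, hD, htD, hDc⟩, ⟨hDS', hD', htD', hDc'⟩, x, hxD, y, hyD', hxy⟩
  choose! D D' hD hD' hb using hex
  have hDS : (⋃ e ∈ R, D e) ⊆ S := Set.iUnion₂_subset fun e he => (hD e he).1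
  have hDU : (⋃ e ∈ R, D' e) ⊆ U := Set.iUnion₂_subset fun e he => (hD' e he).1
  have h1 := ncard_biUnion_le_mul hRfin fun e he => (hD e he).2.2.2
  have h2 := ncard_biUnion_le_mul hRfin fun e he => (hD' e he).2.2.2
  rw [hRcard] at h1 h2
  have h3 := hT _ _ (hDS.trans hSV) (hDU.trans hUV)
    (conn_biUnion (fun e he => (hD e he).2.1) fun e he => (hD e he).2.2.1)
    (conn_biUnion (fun e he => (hD' e he).2.1) fun e he => (hD' e he).2.2.1)
    (hSU.mono hDS hDU) (by lia)
  have h4 : R ⊆ G.between (⋃ e ∈ R, D e) (⋃ e ∈ R, D' e) := fun e he =>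
    between_mono (Set.subset_biUnion_of_mem he) (Set.subset_biUnion_of_mem he) (hb e he)
  have := Set.ncard_le_ncard h4 (hE.subset (between_subset _ _))
  lia

end Radius

section Within

variable {ν : Type u} {A : ν → ν → Prop}

/-- `y` can be reached from `x` in at most `n` steps. -/
def Within (A : ν → ν → Prop) : ℕ → ν → ν → Prop
  | 0, x, y => x = y
  | n + 1, x, y => Within A n x y ∨ ∃ w, Within A n x w ∧ A w y

lemma Within.trans {a b : ℕ} {x y w : ν} (h : Within A a x y) (h' : Within A b y w) :
    Within A (a + b) x w := by
  induction b generalizing w with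
  | zero => cases h'; exact h
  | succ b ih =>
    rcases h' with h' | ⟨s, h', hs⟩
    · exact Or.inl (ih h')
    · exact Or.inr ⟨s, ih h', hs⟩

lemma Within.mono {a b : ℕ} {x y : ν} (h : Within A a x y) (hab : a ≤ b) : Within A b x y := by
  induction hab with
  | refl => exact h
  | step _ ih => exact Or.inl ih

lemma Within.symm (hA : ∀ x y, A x y → A y x) {a : ℕ} {x y : ν} (h : Within A a x y) :
    Within A a y x := by
  induction a generalizing y with
  | zero => exact Eq.symm h
  | succ a ih =>
    rcases h with h | ⟨w, h, hw⟩
    · exact Or.inl (ih h)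
    · have h1 : Within A 1 y w := Or.inr ⟨y, rfl, hA _ _ hw⟩
      have := h1.trans (ih h)
      rwa [add_comm] at this

end Within

variable {ν : Type u} {ε : Type v} {G : Graph ν ε} {r N α ℓ : ℕ} {p : ν → ν} {d : ν → ℕ}

/-- A spanning forest given by a parent function `p` and a depth function `d`, such that the
neighbours of a vertex of depth less than `ℓ` lie in the same tree. -/
structure IsForest (G : Graph ν ε) (ℓ : ℕ) (p : ν → ν) (d : ν → ℕ) : Prop where
  depth_le : ∀ x ∈ V(G), d x ≤ 2 * ℓ
  parent : ∀ x ∈ V(G), 0 < d x → p x ∈ V(G) ∧ d (p x) + 1 = d x ∧ G.Adj (p x) x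
  root_eq : ∀ x y, G.Adj x y → d x < ℓ → p^[d x] x = p^[d y] y

/-- The roots form a maximal set at pairwise distance more than $2\ell$, and `d` is the distance to
them. If `y` is a neighbour of `x` and $d(x)<\ell$, their roots have distance at most
$d(x)+1+d(y)\le2d(x)+2\le2\ell$, so they coincide. -/
lemma exists_isForest (hfin : V(G).Finite) (ℓ : ℕ) : ∃ p d, IsForest G ℓ p d := by
  have hA := adj_symm G
  have hPfin : {R | R ⊆ V(G) ∧ ∀ u ∈ R, ∀ v ∈ R, Within G.Adj (2 * ℓ) u v → u = v}.Finite :=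
    hfin.finite_subsets.subset fun X hX => hX.1
  obtain ⟨R, ⟨hRV, hR⟩, hmax⟩ := hPfin.exists_maximal ⟨∅, Set.empty_subset _, by simp⟩
  have hcov : ∀ x ∈ V(G), ∃ v ∈ R, Within G.Adj (2 * ℓ) v x := by
    intro x hx
    by_contra! hcon
    have hxR : x ∉ R := fun h => hcon x h (Within.mono (a := 0) rfl (by lia))
    refine hxR (hmax ⟨Set.insert_subset hx hRV, ?_⟩ (Set.subset_insert _ _) (Set.mem_insert _ _))
    rintro u (rfl | hu) v (rfl | hv) huv
    · rfl
    · exact absurd (huv.symm hA) (hcon v hv)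
    · exact absurd huv (hcon u hu)
    · exact hR u hu v hv huv
  let d : ν → ℕ := fun x => sInf {n | ∃ v ∈ R, Within G.Adj n v x}
  have hd : ∀ x ∈ V(G), ∃ v ∈ R, Within G.Adj (d x) v x := fun x hx =>
    Nat.sInf_mem (s := {n | ∃ v ∈ R, Within G.Adj n v x}) ⟨2 * ℓ, hcov x hx⟩
  have hdle : ∀ n x, (∃ v ∈ R, Within G.Adj n v x) → d x ≤ n := fun n x h => Nat.sInf_le h
  have hpar : ∀ x ∈ V(G), 0 < d x → ∃ w, w ∈ V(G) ∧ d w + 1 = d x ∧ G.Adj w x := by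
    intro x hx hpos
    obtain ⟨v, hv, h⟩ := hd x hx
    obtain ⟨m, hm⟩ : ∃ m, d x = m + 1 := ⟨d x - 1, by lia⟩
    rw [hm] at h
    rcases h with h | ⟨w, h, hw⟩
    · have := hdle m x ⟨v, hv, h⟩
      lia
    · refine ⟨w, hw.left_mem, ?_, hw⟩
      have h1 := hdle m w ⟨v, hv, h⟩
      obtain ⟨v', hv', h'⟩ := hd w hw.left_mem
      have h2 := hdle (d w + 1) x ⟨v', hv', Or.inr ⟨w, h', hw⟩⟩
      lia
  have hpar' : ∃ p : ν → ν, ∀ x ∈ V(G), 0 < d x →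
      p x ∈ V(G) ∧ d (p x) + 1 = d x ∧ G.Adj (p x) x := by
    classical
    refine ⟨fun x => if h : x ∈ V(G) ∧ 0 < d x then (hpar x h.1 h.2).choose else x, ?_⟩
    intro x hx hpos
    simp only [hx, hpos, and_self, dite_true]
    exact (hpar x hx hpos).choose_spec
  obtain ⟨p, hp⟩ := hpar'
  have hroot : ∀ n, ∀ x ∈ V(G), d x = n → p^[d x] x ∈ R ∧ Within G.Adj (d x) (p^[d x] x) x := by
    intro n
    induction n with
    | zero =>
      intro x hx h0
      obtain ⟨v, hv, h⟩ := hd x hx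
      rw [h0] at h ⊢
      cases h
      exact ⟨hv, rfl⟩
    | succ n ih =>
      intro x hx hn
      obtain ⟨h1, h2, h3⟩ := hp x hx (by lia)
      obtain ⟨h4, h5⟩ := ih (p x) h1 (by lia)
      rw [← h2, Function.iterate_succ_apply]
      exact ⟨h4, Or.inr ⟨_, h5, h3⟩⟩
  refine ⟨p, d, ⟨fun x hx => hdle _ x (hcov x hx), hp, ?_⟩⟩
  intro x y hxy hlt
  obtain ⟨h1, h2⟩ := hroot _ x hxy.left_mem rfl
  obtain ⟨h3, h4⟩ := hroot _ y hxy.right_mem rfl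
  have h5 : d y ≤ d x + 1 := hdle _ y ⟨_, h1, Or.inr ⟨x, h2, hxy⟩⟩
  refine hR _ h1 _ h3 (Within.mono (a := d x + 1 + d y) ?_ (by lia))
  exact Within.trans (y := y) (Or.inr ⟨x, h2, hxy⟩) (h4.symm hA)

/-- The vertices below `x` in the forest. -/
def below (G : Graph ν ε) (p : ν → ν) (d : ν → ℕ) (x : ν) : Set ν :=
  {y | y ∈ V(G) ∧ d x ≤ d y ∧ p^[d y - d x] y = x}

lemma below_subset (x : ν) : G.below p d x ⊆ V(G) := fun _ h => h.1

lemma mem_below_self {x : ν} (hx : x ∈ V(G)) : x ∈ G.below p d x := ⟨hx, le_rfl, by simp⟩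

lemma eq_of_mem_below {x y w : ν} (h : d x = d y) (hx : w ∈ G.below p d x)
    (hy : w ∈ G.below p d y) : x = y := by
  rw [← hx.2.2, ← hy.2.2, h]

namespace IsForest

lemma iterate_mem (hF : IsForest G ℓ p d) {x : ν} (hx : x ∈ V(G)) {i : ℕ} (hi : i ≤ d x) :
    p^[i] x ∈ V(G) ∧ d (p^[i] x) = d x - i := by
  induction i with
  | zero => simpa using hx
  | succ i ih =>
    obtain ⟨h1, h2⟩ := ih (by lia)
    rw [Function.iterate_succ_apply']
    obtain ⟨h3, h4, -⟩ := hF.parent _ h1 (by lia)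
    exact ⟨h3, by lia⟩

lemma mem_below_iterate (hF : IsForest G ℓ p d) {x : ν} (hx : x ∈ V(G)) {i : ℕ} (hi : i ≤ d x) :
    x ∈ G.below p d (p^[i] x) := by
  obtain ⟨-, h2⟩ := hF.iterate_mem hx hi
  exact ⟨hx, by lia, by rw [h2]; congr 2; lia⟩

lemma mem_below_of_iterate (hF : IsForest G ℓ p d) {x y : ν} (hx : x ∈ V(G)) {i : ℕ}
    (hi : i ≤ d x) (h : p^[i] x ∈ G.below p d y) : x ∈ G.below p d y := by
  obtain ⟨-, h2⟩ := hF.iterate_mem hx hi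
  obtain ⟨-, h3, h4⟩ := h
  rw [← Function.iterate_add_apply, h2] at h4
  rw [h2] at h3
  refine ⟨hx, by lia, ?_⟩
  rw [← h4]
  congr 2
  lia

lemma iterate_mem_below (hF : IsForest G ℓ p d) {x y : ν} (hy : y ∈ G.below p d x) {i : ℕ}
    (hi : i ≤ d y - d x) : p^[i] y ∈ G.below p d x := by
  obtain ⟨h1, h2⟩ := hF.iterate_mem hy.1 (i := i) (by lia)
  have := hy.2.1
  refine ⟨h1, by lia, ?_⟩
  rw [← Function.iterate_add_apply, h2]
  conv_rhs => rw [← hy.2.2]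
  congr 2
  lia

lemma below_subset_below (hF : IsForest G ℓ p d) {x y : ν} (hy : y ∈ G.below p d x) :
    G.below p d y ⊆ G.below p d x := by
  intro s hs
  refine hF.mem_below_of_iterate hs.1 (i := d s - d y) (by lia) ?_
  rw [hs.2.2]
  exact hy

lemma root_mem (hF : IsForest G ℓ p d) {x : ν} (hx : x ∈ V(G)) :
    p^[d x] x ∈ V(G) ∧ d (p^[d x] x) = 0 := by
  obtain ⟨h1, h2⟩ := hF.iterate_mem hx (le_refl (d x))
  exact ⟨h1, by lia⟩

lemma mem_below_root_iff (hF : IsForest G ℓ p d) {x y : ν} (hx : x ∈ V(G)) :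
    y ∈ G.below p d (p^[d x] x) ↔ y ∈ V(G) ∧ p^[d y] y = p^[d x] x := by
  have := (hF.root_mem hx).2
  simp [below, this]

/-- The first `m + 1` vertices on the way from `x` to its root. -/
def path (p : ν → ν) (x : ν) (m : ℕ) : Set ν := (fun i => p^[i] x) '' Set.Iic m

lemma path_succ (x : ν) (m : ℕ) : path p x (m + 1) = insert (p^[m + 1] x) (path p x m) := by
  have : Set.Iic (m + 1) = insert (m + 1) (Set.Iic m) := by
    ext i; simp; lia
  rw [path, this, Set.image_insert_eq, path]

lemma path_finite (x : ν) (m : ℕ) : (path p x m).Finite := (Set.finite_Iic m).image _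

lemma conn_path (hF : IsForest G ℓ p d) {x : ν} (hx : x ∈ V(G)) {m : ℕ} (hm : m ≤ d x) :
    Conn G.Adj (path p x m) := by
  induction m with
  | zero =>
    have : path p x 0 = {x} := by ext; simp [path, eq_comm]
    rw [this]
    exact conn_singleton x
  | succ m ih =>
    rw [path_succ]
    refine (ih (by lia)).insert_of_adj (adj_symm G) (x := p^[m] x) ⟨m, by simp, rfl⟩ ?_
    obtain ⟨h1, h2⟩ := hF.iterate_mem hx (i := m) (by lia)
    rw [Function.iterate_succ_apply']
    exact (hF.parent _ h1 (by lia)).2.2.symm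

lemma ncard_path (hF : IsForest G ℓ p d) {x : ν} (hx : x ∈ V(G)) {m : ℕ} (hm : m ≤ d x) :
    (path p x m).ncard = m + 1 := by
  rw [path, Set.InjOn.ncard_image]
  · rw [Set.ncard_eq_toFinset_card']; simp
  · intro i hi j hj hij
    simp only [Set.mem_Iic] at hi hj
    have h1 := (hF.iterate_mem hx (i := i) (by lia)).2
    have h2 := (hF.iterate_mem hx (i := j) (by lia)).2
    simp only at hij
    rw [hij] at h1
    lia

lemma hasRadius (hF : IsForest G ℓ p d) {S : Set ν} {x : ν} (hx : x ∈ S)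
    (hS : ∀ y ∈ S, y ∈ G.below p d x ∧ ∀ i ≤ d y - d x, p^[i] y ∈ S) :
    HasRadius G.Adj (2 * ℓ) S := by
  refine ⟨x, hx, fun y hy => ?_⟩
  obtain ⟨hyx, hyS⟩ := hS y hy
  refine ⟨path p y (d y - d x), ?_, hF.conn_path hyx.1 (by lia), ⟨d y - d x, by simp, hyx.2.2⟩,
    ⟨0, by simp, rfl⟩, path_finite _ _, ?_⟩
  · rintro _ ⟨i, hi, rfl⟩
    exact hyS i hi
  · rw [hF.ncard_path hyx.1 (by lia)]
    have := hF.depth_le y hyx.1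
    lia

lemma hasRadius_below (hF : IsForest G ℓ p d) {x : ν} (hx : x ∈ V(G)) :
    HasRadius G.Adj (2 * ℓ) (G.below p d x) :=
  hF.hasRadius (mem_below_self hx) fun _ hy => ⟨hy, fun _ hi => hF.iterate_mem_below hy hi⟩

lemma hasRadius_below_sdiff (hF : IsForest G ℓ p d) {x y : ν} (hx : x ∈ V(G))
    (hxy : d x < d y) :
    HasRadius G.Adj (2 * ℓ) (G.below p d x \ G.below p d y) := by
  refine hF.hasRadius (x := x) ⟨mem_below_self hx, fun h => ?_⟩ fun s hs => ⟨hs.1, fun i hi =>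
    ⟨hF.iterate_mem_below hs.1 hi, fun h => hs.2 ?_⟩⟩
  · have := h.2.1
    lia
  · exact hF.mem_below_of_iterate hs.1.1 (by lia) h

/-- A vertex is not far below an ancestor with a small subtree. -/
lemma depth_lt (hF : IsForest G ℓ p d) (hfin : V(G).Finite) {s y : ν} (hs : s ∈ G.below p d y)
    (hy : (G.below p d y).ncard ≤ α) : d s < d y + α := by
  have h1 : path p s (d s - d y) ⊆ G.below p d y := by
    rintro _ ⟨i, hi, rfl⟩
    exact hF.iterate_mem_below hs hi
  have h2 := Set.ncard_le_ncard h1 (hfin.subset (below_subset _))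
  rw [hF.ncard_path hs.1 (by lia)] at h2
  lia

lemma between_eq_empty (hF : IsForest G ℓ p d) {v : ν} (hv : v ∈ V(G)) {S : Set ν}
    (hS : S ⊆ G.below p d (p^[d v] v)) (hd : ∀ s ∈ S, d s < ℓ) :
    G.between S (V(G) \ G.below p d (p^[d v] v)) = ∅ := by
  rw [Set.eq_empty_iff_forall_notMem]
  rintro e ⟨s, hs, y, hy, he⟩
  have h1 := ((hF.mem_below_root_iff hv).1 (hS hs)).2
  have h2 := hF.root_eq s y ⟨e, he⟩ (hd s hs)
  exact hy.2 ((hF.mem_below_root_iff hv).2 ⟨hy.1, by rw [← h2, h1]⟩)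

end IsForest

end Graph

/-! ### Exponential growth inside a tree. -/

namespace Graph

universe u v

variable {ν : Type u} {ε : Type v} {G : Graph ν ε} {r N α β ℓ : ℕ} {p : ν → ν} {d : ν → ℕ}

/-- A large loosely connected graph without short theta graphs does not consist of a vertex with
small branches attached to it. -/
lemma LooselyConnected.false_of_hub (hG : G.LooselyConnected α β) (hβ : 2 ≤ β)
    (hT : ThetaSparse G r N) (hfin : V(G).Finite) (hE : E(G).Finite)
    (hr : 1 ≤ r) {x : ν} (hx : x ∈ V(G)) (br : ν → Set ν)
    (hbr : ∀ u ∈ V(G) \ {x}, u ∈ br u ∧ br u ⊆ V(G) \ {x} ∧ Conn G.Adj (br u) ∧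
      (br u).ncard ≤ α ∧ (∀ w ∈ br u, br w = br u) ∧ ∃ y ∈ br u, G.Adj x y)
    (hn : 1 + α + α * r < V(G).ncard) (hn' : 3 * α + 1 < V(G).ncard)
    (hN : 1 + α * r + r < N + 2) : False := by
  have hA := adj_symm G
  have hVx : (V(G) \ {x}).ncard + 1 = V(G).ncard := by
    rw [Set.ncard_sdiff_singleton_of_mem hx]; lia
  obtain ⟨D, hDV, hD, hDcl, hDc⟩ := exists_giant hA (hfin.subset (Set.sdiff_subset (t := {x})))
    (a := α) (fun X hX hcl => hG.ncard_le_or Set.sdiff_subset (by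
      rw [Set.sdiff_sdiff_cancel_left (by simpa using hx), Set.ncard_singleton]; lia) hX hcl)
    (by lia)
  have hDc' := Set.ncard_sdiff_add_ncard_of_subset hDV (hfin.subset Set.sdiff_subset)
  have hDfin : D.Finite := hfin.subset (hDV.trans Set.sdiff_subset)
  have hbrD : ∀ u ∈ D, br u ⊆ D := by
    intro u hu
    obtain ⟨h1, h2, h3, -⟩ := hbr u (hDV hu)
    exact h3 D ⟨u, h1, hu⟩ fun a _ haD b hb hab => hDcl a haD b (h2 hb) hab
  have hbet : ∀ u ∈ D, 1 ≤ (G.between {x} (br u)).ncard := by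
    intro u hu
    obtain ⟨-, -, -, -, -, y, hy, e, he⟩ := hbr u (hDV hu)
    exact (Set.ncard_pos (hE.subset (between_subset _ _))).2 ⟨e, x, rfl, y, hy, he⟩
  -- Inside the giant component `D` of `G - x`, a connected union of branches grows by one branch at
  -- a time. Each adds at most `α` vertices and at least one edge to `x`, so `r` of them contradict
  -- `hT`.
  have key : ∀ j, j < r → ∃ W ⊆ D, W.Nonempty ∧ Conn G.Adj W ∧ (∀ u ∈ W, br u ⊆ W) ∧
      W.ncard ≤ α * (j + 1) ∧ j + 1 ≤ (G.between {x} W).ncard := by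
    intro j
    induction j with
    | zero =>
      intro _
      obtain ⟨u, hu⟩ : D.Nonempty := Set.nonempty_of_ncard_ne_zero (by lia)
      obtain ⟨h1, h2, h3, h4, h5, h6⟩ := hbr u (hDV hu)
      exact ⟨br u, hbrD u hu, ⟨u, h1⟩, h3, fun w hw => (h5 w hw).subset, by lia, hbet u hu⟩
    | succ j ih =>
      intro hj
      obtain ⟨W, hWD, ⟨t, ht⟩, hW, hsat, hWc, hWb⟩ := ih (by lia)
      have hlt : W.ncard < D.ncard := by
        have : α * (j + 1) ≤ α * r := Nat.mul_le_mul_left _ (by lia)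
        lia
      obtain ⟨y, hyD, hyW⟩ : ∃ y ∈ D, y ∉ W := by
        by_contra! hcon
        have := Set.ncard_le_ncard (show D ⊆ W from hcon) (hDfin.subset hWD)
        lia
      obtain ⟨a, -, haW, b, hbD, hbW, hab⟩ := hD.exists_adj ⟨t, hWD ht, ht⟩ hyD hyW
      obtain ⟨h1, h2, h3, h4, h5, h6⟩ := hbr b (hDV hbD)
      have hdisj : ∀ w ∈ W, w ∉ br b := fun w hw hwb => hbW (hsat w hw (h5 w hwb ▸ h1))
      refine ⟨W ∪ br b, Set.union_subset hWD (hbrD b hbD), ⟨t, Or.inl ht⟩,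
        hW.union_of_adj hA h3 haW h1 hab, ?_, ?_, ?_⟩
      · rintro u (hu | hu)
        · exact (hsat u hu).trans Set.subset_union_left
        · rw [h5 u hu]
          exact Set.subset_union_right
      · have := Set.ncard_union_le W (br b)
        rw [Nat.mul_succ]
        lia
      · rw [between_union_right, Set.ncard_union_eq ?_ (hE.subset (between_subset _ _))
          (hE.subset (between_subset _ _))]
        · have := hbet b hbD
          lia
        · rw [Set.disjoint_left]
          rintro e ⟨_, rfl, w, hw, he⟩ ⟨_, rfl, w', hw', he'⟩
          rw [he.right_unique he'] at hw
          exact hdisj _ hw hw'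
  obtain ⟨W, hWD, -, hW, -, hWc, hWb⟩ := key (r - 1) (by lia)
  rw [Nat.sub_add_cancel hr] at hWc hWb
  have := hT {x} W (by simpa using hx) (hWD.trans (hDV.trans Set.sdiff_subset)) (conn_singleton x)
    hW (Set.disjoint_singleton_left.2 fun h => (hDV (hWD h)).2 rfl)
    (by rw [Set.ncard_singleton]; lia)
  lia

namespace IsForest

/-- A subtree with more than `α` vertices sends an edge out of its tree. -/
lemma one_le_ncard_between (hF : IsForest G ℓ p d) (hT : ThetaSparse G r N) (hfin : V(G).Finite)
    (hE : E(G).Finite) (hr : 2 ≤ r) (hG : G.LooselyConnected α (2 * r - 1))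
    (hn : 2 * r - 1 + 2 * α < V(G).ncard) (hN : 2 * (r * (2 * ℓ + 1)) + r < N + 2)
    {x : ν} (hx : x ∈ V(G)) (hα : α < (G.below p d x).ncard) (hd : α + 1 ≤ d x) :
    1 ≤ (G.between (G.below p d x) (V(G) \ G.below p d (p^[d x] x))).ncard := by
  by_contra! hlt
  obtain ⟨hvV, hv⟩ := hF.root_mem hx
  set v := p^[d x] x with hvdef
  have hxv : G.below p d x ⊆ G.below p d v :=
    hF.below_subset_below (hF.mem_below_iterate hx le_rfl)
  have h1 := hT.ncard_between_lt hE (below_subset x) (Set.sdiff_subset.trans (below_subset v))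
    (hF.hasRadius_below hx) (hF.hasRadius_below_sdiff (x := v) (y := x) hvV (by lia))
    Set.disjoint_sdiff_right hN
  have h2 : V(G) \ G.below p d x =
      (G.below p d v \ G.below p d x) ∪ (V(G) \ G.below p d v) := by
    ext s
    have := @hxv s
    have := @below_subset _ _ G p d v s
    simp only [Set.mem_sdiff, Set.mem_union]
    tauto
  have h3 := ncard_between_union_right_le (G := G) (G.below p d x)
    (G.below p d v \ G.below p d x) (V(G) \ G.below p d v)
  rw [← h2] at h3
  obtain ⟨hp1, hp2, -⟩ := hF.parent x hx (by lia)
  refine hG.false_of_cut hE (below_subset x) hα ?_ (by lia) hn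
  -- The proper ancestors of `x`, at least `α + 1` in number, make the other side of the cut large.
  have h4 : path p (p x) (d x - 1) ⊆ V(G) \ G.below p d x := by
    rintro _ ⟨i, hi, rfl⟩
    simp only [Set.mem_Iic] at hi
    obtain ⟨h5, h6⟩ := hF.iterate_mem hp1 (i := i) (by lia)
    refine ⟨h5, fun h => ?_⟩
    have := h.2.1
    simp only at this
    lia
  have h5 := Set.ncard_le_ncard h4 (hfin.subset Set.sdiff_subset)
  rw [hF.ncard_path hp1 (by lia)] at h5
  lia

/-- A subtree with more than `α` vertices that starts at small depth branches. -/
lemma exists_two_below (hF : IsForest G ℓ p d) (hT : ThetaSparse G r N) (hfin : V(G).Finite)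
    (hE : E(G).Finite) (hr : 2 ≤ r) (hG : G.LooselyConnected α (2 * r - 1))
    (hn : 2 * r - 1 + 2 * α < V(G).ncard) (hN : 2 * (r * (2 * ℓ + 1)) + r < N + 2)
    {x : ν} (hx : x ∈ V(G)) (hα : α < (G.below p d x).ncard) (hd : α + 1 ≤ d x)
    (hdℓ : d x + 2 * α < ℓ) :
    ∃ y ∈ G.below p d x, ∃ y' ∈ G.below p d x, y ≠ y' ∧ d y = d x + α + 1 ∧
      d y' = d x + α + 1 ∧ α < (G.below p d y).ncard ∧ α < (G.below p d y').ncard := by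
  by_contra! hcon
  obtain ⟨hvV, hv⟩ := hF.root_mem hx
  have hxv : G.below p d x ⊆ G.below p d (p^[d x] x) :=
    hF.below_subset_below (hF.mem_below_iterate hx le_rfl)
  -- A light subtree has fewer than `α + 1` levels, so the vertices not under a heavy vertex `α + 1`
  -- levels below `x` have depth less than `ℓ` and no neighbour in another tree.
  have hdep : ∀ s ∈ G.below p d x, (∀ y ∈ G.below p d x, d y = d x + α + 1 →
      s ∈ G.below p d y → (G.below p d y).ncard ≤ α) → d s < ℓ := by
    intro s hs hsmall
    by_cases hsd : d s < d x + α + 1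
    · lia
    obtain ⟨h1, h2⟩ := hF.iterate_mem hs.1 (i := d s - (d x + α + 1)) (by lia)
    have h3 := hF.mem_below_iterate hs.1 (i := d s - (d x + α + 1)) (by lia)
    have h4 := hF.iterate_mem_below hs (i := d s - (d x + α + 1)) (by lia)
    have h5 := hF.depth_lt hfin h3 (hsmall _ h4 (by lia) h3)
    lia
  by_cases hex : ∃ y ∈ G.below p d x, d y = d x + α + 1 ∧ α < (G.below p d y).ncard
  · obtain ⟨y, hyx, hyd, hyα⟩ := hex
    have hyx' := hF.below_subset_below hyx
    have hempty := hF.between_eq_empty hx (S := G.below p d x \ G.below p d y)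
      (Set.sdiff_subset.trans hxv) (by
        intro s hs
        refine hdep s hs.1 fun y' hy' hyd' hsy' => ?_
        by_contra! hc
        refine absurd hc (not_lt.2 (hcon y hyx y' hy' ?_ hyd hyd' hyα))
        rintro rfl
        exact hs.2 hsy')
    set v := p^[d x] x with hvdef
    -- The piece between `x` and `y` sends at most `r - 1` edges to the tree outside the subtree of
    -- `x` and at most `r - 1` into the subtree of `y`; this is where the order `2 * r - 1` is
    -- needed.
    have h1 := hT.ncard_between_lt hE (Set.sdiff_subset.trans (below_subset x))
      (Set.sdiff_subset.trans (below_subset v))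
      (hF.hasRadius_below_sdiff (x := x) (y := y) hx (by lia))
      (hF.hasRadius_below_sdiff (x := v) (y := x) hvV (by lia))
      (Set.disjoint_sdiff_right.mono_left Set.sdiff_subset) hN
    have h2 := hT.ncard_between_lt hE (Set.sdiff_subset.trans (below_subset x)) (below_subset y)
      (hF.hasRadius_below_sdiff (x := x) (y := y) hx (by lia)) (hF.hasRadius_below hyx.1)
      Set.disjoint_sdiff_left hN
    have h3 : V(G) \ (G.below p d x \ G.below p d y) =
        ((G.below p d v \ G.below p d x) ∪ G.below p d y) ∪ (V(G) \ G.below p d v) := by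
      ext s
      have := @hxv s
      have := @hyx' s
      have := @below_subset _ _ G p d v s
      simp only [Set.mem_sdiff, Set.mem_union]
      tauto
    have h4 := ncard_between_union_right_le (G := G) (G.below p d x \ G.below p d y)
      ((G.below p d v \ G.below p d x) ∪ G.below p d y) (V(G) \ G.below p d v)
    have h5 := ncard_between_union_right_le (G := G) (G.below p d x \ G.below p d y)
      (G.below p d v \ G.below p d x) (G.below p d y)
    rw [← h3, hempty, Set.ncard_empty] at h4
    refine hG.false_of_cut hE (S := G.below p d x \ G.below p d y)
      (Set.sdiff_subset.trans (below_subset x)) ?_ ?_ (by lia) hn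
    · obtain ⟨hp1, hp2, -⟩ := hF.parent y hyx.1 (by lia)
      -- The `α + 1` vertices from the parent of `y` up to `x`; the distance of the levels is chosen
      -- to provide them.
      have h6 : path p (p y) α ⊆ G.below p d x \ G.below p d y := by
        rintro _ ⟨i, hi, rfl⟩
        simp only [Set.mem_Iic] at hi
        have h7 := hF.iterate_mem_below hyx (i := i + 1) (by lia)
        have h8 := (hF.iterate_mem hyx.1 (i := i + 1) (by lia)).2
        refine ⟨h7, fun h => ?_⟩
        have := h.2.1
        rw [Function.iterate_succ_apply] at h8
        simp only at this
        lia
      have h7 := Set.ncard_le_ncard h6 ((hfin.subset (below_subset x)).subset Set.sdiff_subset)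
      rw [hF.ncard_path hp1 (by lia)] at h7
      lia
    · refine lt_of_lt_of_le hyα (Set.ncard_le_ncard ?_ (hfin.subset Set.sdiff_subset))
      exact fun s hs => ⟨hs.1, fun h => h.2 hs⟩
  · push Not at hex
    have hempty := hF.between_eq_empty hx hxv (fun s hs =>
      hdep s hs fun y hy hyd _ => hex y hy hyd)
    have := hF.one_le_ncard_between hT hfin hE hr hG hn hN hx hα hd
    rw [hempty, Set.ncard_empty] at this
    lia

/-- The number of edges leaving the tree from a subtree grows exponentially. -/
lemma two_pow_le_ncard_between (hF : IsForest G ℓ p d) (hT : ThetaSparse G r N)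
    (hfin : V(G).Finite)
    (hE : E(G).Finite) (hr : 2 ≤ r) (hG : G.LooselyConnected α (2 * r - 1))
    (hn : 2 * r - 1 + 2 * α < V(G).ncard) (hN : 2 * (r * (2 * ℓ + 1)) + r < N + 2) (j : ℕ) :
    ∀ x ∈ V(G), α < (G.below p d x).ncard → α + 1 ≤ d x → d x + j * (α + 1) + α ≤ ℓ →
      2 ^ j ≤ (G.between (G.below p d x) (V(G) \ G.below p d (p^[d x] x))).ncard := by
  induction j with
  | zero =>
    intro x hx hα hd _
    simpa using hF.one_le_ncard_between hT hfin hE hr hG hn hN hx hα hd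
  | succ j ih =>
    intro x hx hα hd hdℓ
    rw [Nat.succ_mul] at hdℓ
    obtain ⟨y, hy, y', hy', hne, hyd, hyd', hyα, hyα'⟩ :=
      hF.exists_two_below hT hfin hE hr hG hn hN hx hα hd (by lia)
    have h1 := ih y hy.1 hyα (by lia) (by lia)
    have h2 := ih y' hy'.1 hyα' (by lia) (by lia)
    have hxv : G.below p d x ⊆ G.below p d (p^[d x] x) :=
      hF.below_subset_below (hF.mem_below_iterate hx le_rfl)
    have hrt : ∀ w ∈ G.below p d x, p^[d w] w = p^[d x] x := fun w hw =>
      ((hF.mem_below_root_iff hx).1 (hxv hw)).2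
    rw [hrt y hy] at h1
    rw [hrt y' hy'] at h2
    set v := p^[d x] x
    have hf : ∀ A B : Set ν, (G.between A B).Finite := fun A B => hE.subset (between_subset _ _)
    have h3 : G.between (G.below p d y) (V(G) \ G.below p d v) ∪
        G.between (G.below p d y') (V(G) \ G.below p d v) ⊆
        G.between (G.below p d x) (V(G) \ G.below p d v) :=
      Set.union_subset (between_mono (hF.below_subset_below hy) subset_rfl)
        (between_mono (hF.below_subset_below hy') subset_rfl)
    have h4 := Set.ncard_le_ncard h3 (hf _ _)
    rw [Set.ncard_union_eq ?_ (hf _ _) (hf _ _)] at h4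
    · rw [pow_succ]
      lia
    · rw [Set.disjoint_left]
      rintro e ⟨a, ha, b, hb, he⟩ ⟨a', ha', b', hb', he'⟩
      rcases he.left_eq_or_eq he' with rfl | rfl
      · exact hne (eq_of_mem_below (by lia) ha ha')
      · exact hb'.2 (hxv (hF.below_subset_below hy ha))

/-- Every tree contains a large subtree that starts at depth `α + 1`. -/
lemma exists_heavy (hF : IsForest G ℓ p d) (hT : ThetaSparse G r N) (hfin : V(G).Finite)
    (hE : E(G).Finite) (hconn : Conn G.Adj V(G)) (hr : 2 ≤ r)
    (hα : 1 ≤ α) (hG : G.LooselyConnected α (2 * r - 1))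
    (hn : 2 * r - 1 + 2 * α < V(G).ncard) (hN : 2 * (r * (2 * ℓ + 1)) + r < N + 2)
    (hNn : N + 2 ≤ V(G).ncard + r) (hℓ : 2 * α < ℓ) {v : ν} (hv : v ∈ V(G)) (hdv : d v = 0) :
    ∃ x ∈ G.below p d v, d x = α + 1 ∧ α < (G.below p d x).ncard := by
  classical
  by_contra! hcon
  have hαr : r * (4 * α) + 2 * r < N := by
    have : r * (2 * α + 1) ≤ r * ℓ := Nat.mul_le_mul_left _ hℓ
    lia
  have hαr' : α * r = r * α := mul_comm _ _
  have hrα : 2 * α ≤ r * α := Nat.mul_le_mul_right _ hr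
  have hdep : ∀ s ∈ G.below p d v, d s < ℓ := by
    intro s hs
    by_cases hsd : d s < α + 1
    · lia
    have h3 := hF.mem_below_iterate hs.1 (i := d s - (α + 1)) (by lia)
    have h4 := hF.iterate_mem_below hs (i := d s - (α + 1)) (by lia)
    have h2 := (hF.iterate_mem hs.1 (i := d s - (α + 1)) (by lia)).2
    have h5 := hF.depth_lt hfin h3 (hcon _ h4 (by lia))
    lia
  -- Without a heavy subtree at depth `α + 1` the tree stays above level `ℓ`, so no edge leaves it.
  have hVv : G.below p d v = V(G) := by
    refine (below_subset v).antisymm (hconn _ ⟨v, hv, mem_below_self hv⟩ ?_)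
    intro a ha hav b hb hab
    have h1 := hF.root_eq a b hab (hdep a hav)
    have h2 := hav.2.2
    rw [hdv, Nat.sub_zero] at h2
    exact ⟨hb, by lia, by rw [hdv, Nat.sub_zero, ← h1, h2]⟩
  -- For a deepest heavy `x` all child subtrees are light. What is not below `x` is light as well,
  -- since otherwise fewer than `r` edges cut it off. So `x` is a hub: the branches are the child
  -- subtrees and the remainder.
  obtain ⟨x, ⟨hxV, hxα⟩, hmax⟩ := Set.exists_max_image
    {x | x ∈ V(G) ∧ α < (G.below p d x).ncard} d (hfin.subset fun x hx => hx.1)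
    ⟨v, hv, by rw [hVv]; lia⟩
  have hlight : ∀ y ∈ V(G), d x < d y → (G.below p d y).ncard ≤ α := by
    intro y hy hlt
    by_contra! hc
    have := hmax y ⟨hy, hc⟩
    lia
  have hx0 : d x = 0 → G.below p d x = V(G) := by
    intro h0
    have hxv : x ∈ G.below p d v := by rw [hVv]; exact hxV
    have := hxv.2.2
    rw [h0, hdv] at this
    simp only [Nat.sub_zero, Function.iterate_zero, id] at this
    rw [this, hVv]
  have hrad : 0 < d x → HasRadius G.Adj (2 * ℓ) (V(G) \ G.below p d x) := by
    intro h0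
    rw [← hVv]
    exact hF.hasRadius_below_sdiff hv (by lia)
  by_cases hbig : α < (V(G) \ G.below p d x).ncard
  · have h0 : 0 < d x := by
      by_contra hc
      rw [hx0 (by lia)] at hbig
      simp at hbig
    have h1 := hT.ncard_between_lt hE (below_subset x) Set.sdiff_subset (hF.hasRadius_below hxV)
      (hrad h0) Set.disjoint_sdiff_right hN
    exact hG.false_of_cut hE (below_subset x) hxα hbig (by lia) hn
  refine hG.false_of_hub (by lia) hT hfin hE (by lia) hxV
    (fun u => if u ∈ G.below p d x then G.below p d (p^[d u - (d x + 1)] u)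
      else V(G) \ G.below p d x) ?_ (by lia) (by lia) (by lia)
  rintro u ⟨huV, hux⟩
  by_cases hu : u ∈ G.below p d x
  · simp only [hu, if_true]
    have hlt : d x < d u := by
      refine lt_of_le_of_ne hu.2.1 fun h => hux ?_
      have := hu.2.2
      rw [h] at this
      simpa using this
    obtain ⟨h1, h2⟩ := hF.iterate_mem huV (i := d u - (d x + 1)) (by lia)
    have h3 := hF.mem_below_iterate huV (i := d u - (d x + 1)) (by lia)
    have h4 := hF.iterate_mem_below hu (i := d u - (d x + 1)) (by lia)
    have hpc : p (p^[d u - (d x + 1)] u) = x := by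
      have : (d u - (d x + 1)).succ = d u - d x := by lia
      rw [← Function.iterate_succ_apply' p, this, hu.2.2]
    set c := p^[d u - (d x + 1)] u with hc
    have hcd : d c = d x + 1 := by lia
    refine ⟨h3, fun w hw => ⟨hw.1, fun h => ?_⟩, (hF.hasRadius_below h1).conn,
      hlight c h1 (by lia), fun w hw => ?_, c, mem_below_self h1, ?_⟩
    · have := hw.2.1
      rw [Set.mem_singleton_iff.1 h] at this
      lia
    · have hwx := hF.below_subset_below h4 hw
      rw [if_pos hwx, ← hcd, hw.2.2]
    · have := (hF.parent c h1 (by lia)).2.2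
      rwa [hpc] at this
  · simp only [hu, if_false]
    have h0 : 0 < d x := by
      by_contra hc
      exact hu (by rw [hx0 (by lia)]; exact huV)
    obtain ⟨hp1, hp2, hp3⟩ := hF.parent x hxV h0
    refine ⟨⟨huV, hu⟩, fun w hw => ⟨hw.1, fun h => hw.2 ?_⟩, (hrad h0).conn, by lia, fun w hw => ?_,
      p x, ⟨hp1, fun h => ?_⟩, hp3.symm⟩
    · rw [Set.mem_singleton_iff.1 h]
      exact mem_below_self hxV
    · rw [if_neg hw.2]
    · have := h.2.1
      lia

end IsForest

end Graph

/-! ### Clique models in dense sets. -/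

namespace Graph

universe u v

variable {ν : Type u} {A K : ν → ν → Prop}

/-- Disjoint connected subsets `B i` of `X`, any two of which are adjacent. -/
def HasCliqueModel (A : ν → ν → Prop) (X : Set ν) (k : ℕ) : Prop :=
  ∃ B : Fin k → Set ν, (∀ i, (B i).Nonempty) ∧ (∀ i, B i ⊆ X) ∧ (∀ i, Conn A (B i)) ∧
    (∀ i j, i ≠ j → Disjoint (B i) (B j)) ∧ ∀ i j, i ≠ j → ∃ x ∈ B i, ∃ y ∈ B j, A x y

-- Greedy choice: each chosen vertex discards at most `s` vertices, itself included because `K` is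
-- irreflexive.
open Classical in
lemma exists_clique (hirr : ∀ x, ¬ K x x) (hsymm : ∀ x y, K x y → K y x) {s : ℕ} (k : ℕ) :
    ∀ Y : Finset ν, (∀ x ∈ Y, (Y.filter fun y => ¬ K x y).card ≤ s) → k * s ≤ Y.card →
      (0 < k → 0 < s) →
      ∃ T ⊆ Y, T.card = k ∧ ∀ x ∈ T, ∀ y ∈ T, x ≠ y → K x y := by
  induction k with
  | zero => exact fun Y _ _ _ => ⟨∅, by simp⟩
  | succ k ih =>
    intro Y hY hc hs
    have hs := hs (by lia)
    rw [Nat.succ_mul] at hc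
    obtain ⟨x, hx⟩ : Y.Nonempty := Finset.card_pos.1 (by lia)
    have h1 := Finset.card_filter_add_card_filter_not (s := Y) (fun y => K x y)
    have h2 := hY x hx
    obtain ⟨T, hTY, hTc, hT⟩ := ih (Y.filter fun y => K x y) (by
      intro w hw
      refine (Finset.card_le_card ?_).trans (hY w (Finset.mem_of_mem_filter w hw))
      exact Finset.filter_subset_filter _ (Finset.filter_subset _ _)) (by lia) (fun _ => hs)
    have hxT : x ∉ T := fun h => hirr x (Finset.mem_filter.1 (hTY h)).2
    refine ⟨insert x T, ?_, by rw [Finset.card_insert_of_notMem hxT, hTc], ?_⟩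
    · exact Finset.insert_subset hx (hTY.trans (Finset.filter_subset _ _))
    · have h3 : ∀ y ∈ T, K x y := fun y hy => (Finset.mem_filter.1 (hTY hy)).2
      intro a ha b hb hab
      rcases Finset.mem_insert.1 ha with rfl | ha' <;>
        rcases Finset.mem_insert.1 hb with rfl | hb'
      · exact absurd rfl hab
      · exact h3 b hb'
      · exact hsymm _ _ (h3 a ha')
      · exact hT a ha' b hb' hab

lemma Conn.insert_of_eq_or_adj (hA : ∀ x y, A x y → A y x) {S : Set ν} (hS : Conn A S) {x y : ν}
    (hx : x ∈ S) (hxy : y = x ∨ A x y) : Conn A (insert y S) := by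
  rcases hxy with rfl | h
  · rwa [Set.insert_eq_of_mem hx]
  · exact hS.insert_of_adj hA hx h

open Classical in
/-- In a connected set with large minimum degree any two vertices are close. -/
lemma exists_short_connection (hsymm : ∀ x y, K x y → K y x) (hirr : ∀ x, ¬ K x x)
    {Y : Finset ν} (hY : Conn K (Y : Set ν)) {m : ℕ} (hdeg : ∀ x ∈ Y, m ≤ (Y.filter (K x)).card)
    (hc : Y.card < 3 * (m + 1)) {a b : ν} (ha : a ∈ Y) (hb : b ∈ Y) :
    ∃ D ⊆ Y, Conn K (D : Set ν) ∧ a ∈ D ∧ b ∈ D ∧ D.card ≤ 6 := by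
  let N : ν → Finset ν := fun x => insert x (Y.filter (K x))
  have hNY : ∀ x ∈ Y, N x ⊆ Y := fun x hx => Finset.insert_subset hx (Finset.filter_subset _ _)
  have hNc : ∀ x ∈ Y, m + 1 ≤ (N x).card := by
    intro x hx
    rw [Finset.card_insert_of_notMem (fun h => hirr x (Finset.mem_filter.1 h).2)]
    exact Nat.succ_le_succ (hdeg x hx)
  have hmem : ∀ x w, w ∈ N x → w = x ∨ K x w := by
    intro x w hw
    rcases Finset.mem_insert.1 hw with h | h
    · exact Or.inl h
    · exact Or.inr (Finset.mem_filter.1 h).2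
  have hmeet : ∀ x ∈ Y, ∀ y ∈ Y, ¬ Disjoint (N x) (N y) →
      ∃ D ⊆ Y, Conn K (D : Set ν) ∧ x ∈ D ∧ y ∈ D ∧ D.card ≤ 3 := by
    intro x hx y hy hd
    obtain ⟨w, hw, hw'⟩ := Finset.not_disjoint_iff.1 hd
    refine ⟨{y, w, x}, ?_, ?_, by simp, by simp, Finset.card_le_three⟩
    · exact Finset.insert_subset hy (Finset.insert_subset (hNY x hx hw) (by simpa using hx))
    · have h1 : Conn K (insert w {x}) :=
        (conn_singleton x).insert_of_eq_or_adj hsymm rfl (hmem x w hw)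
      have h2 : y = w ∨ K w y := (hmem y w hw').imp Eq.symm (hsymm _ _)
      have := h1.insert_of_eq_or_adj hsymm (Set.mem_insert w _) h2
      simpa using this
  by_cases hab : Disjoint (N a) (N b)
  swap
  · obtain ⟨D, h1, h2, h3, h4, h5⟩ := hmeet a ha b hb hab
    exact ⟨D, h1, h2, h3, h4, by lia⟩
  -- Three disjoint closed neighbourhoods would need `3 * (m + 1)` vertices, so every vertex is
  -- within two steps of `a` or of `b`. Some edge joins the two regions, giving three vertices on
  -- each side.
  have hcov : ∀ c ∈ Y, ¬ Disjoint (N a) (N c) ∨ ¬ Disjoint (N b) (N c) := by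
    intro c hc'
    by_contra! hcon
    have h1 : Disjoint (N a ∪ N b) (N c) := Finset.disjoint_union_left.2 hcon
    have h2 := Finset.card_le_card (Finset.union_subset
      (Finset.union_subset (hNY a ha) (hNY b hb)) (hNY c hc'))
    rw [Finset.card_union_of_disjoint h1, Finset.card_union_of_disjoint hab] at h2
    have := hNc a ha
    have := hNc b hb
    have := hNc c hc'
    lia
  have haa : ¬ Disjoint (N a) (N a) := by
    rw [disjoint_self]
    exact Finset.ne_empty_of_mem (Finset.mem_insert_self a _)
  obtain ⟨x, hxY, hx, y, hyY, hy, hxy⟩ := hY.exists_adj (X := {c | ¬ Disjoint (N a) (N c)})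
    ⟨a, ha, haa⟩ hb (by simpa using hab)
  obtain ⟨D, h1, h2, h3, h4, h5⟩ := hmeet a ha x hxY hx
  obtain ⟨D', h1', h2', h3', h4', h5'⟩ := hmeet b hb y hyY ((hcov y hyY).resolve_left hy)
  refine ⟨D ∪ D', Finset.union_subset h1 h1', ?_, Finset.mem_union_left _ h3,
    Finset.mem_union_right _ h3', (Finset.card_union_le _ _).trans (by lia)⟩
  rw [Finset.coe_union]
  exact h2.union_of_adj hsymm h2' h4 h4' hxy

open Classical in
/-- A robustly connected set of large minimum degree has a clique model. -/
lemma hasCliqueModel_of_robust (hsymm : ∀ x y, K x y → K y x) (hirr : ∀ x, ¬ K x x)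
    {X : Finset ν} {m s k : ℕ} (hX : X.card ≤ 2 * m + 1) (hne : X.Nonempty)
    (hdeg : ∀ x ∈ X, m ≤ (X.filter (K x)).card) (hs : 3 * s ≤ m) (hk : 6 * k * k ≤ s)
    (hs0 : 0 < s) (hrob : ∀ Z ⊆ X, Z.card ≤ s → Conn K ((X \ Z : Finset ν) : Set ν)) :
    HasCliqueModel K X k := by
  have hXm : m < X.card := by
    obtain ⟨x, hx⟩ := hne
    have h1 : X.filter (K x) ⊂ X := Finset.filter_ssubset.2 ⟨x, hx, hirr x⟩
    have := Finset.card_lt_card h1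
    have := hdeg x hx
    lia
  have hout : ∀ Z ⊆ X, Z.card ≤ s → ∀ x ∈ X, m - s ≤ ((X \ Z).filter (K x)).card := by
    intro Z _ hZc x hx
    have h1 : X.filter (K x) ⊆ (X \ Z).filter (K x) ∪ Z := by
      intro y hy
      simp only [Finset.mem_filter, Finset.mem_union, Finset.mem_sdiff] at hy ⊢
      tauto
    have h2 := Finset.card_le_card h1
    have h3 := Finset.card_union_le ((X \ Z).filter (K x)) Z
    have h4 := hdeg x hx
    lia
  -- The branch sets use at most $6k^2\le s$ vertices in all, so the rest stays connected with
  -- minimum degree at least $m-s$, and $3s\le m$ keeps its size below $3(m-s+1)$. The next branch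
  -- set joins `x` by short connections to a neighbour of each earlier one.
  have key : ∀ i ≤ k, ∃ B : ℕ → Finset ν, (∀ j < i, (B j).Nonempty ∧ B j ⊆ X ∧
      Conn K (B j : Set ν) ∧ (B j).card ≤ 6 * k) ∧
      ∀ j < i, ∀ j' < j, Disjoint (B j) (B j') ∧ ∃ x ∈ B j, ∃ y ∈ B j', K x y := by
    intro i
    induction i with
    | zero => exact fun _ => ⟨fun _ => ∅, by simp, by simp⟩
    | succ i ih =>
      intro hi
      obtain ⟨B, hB, hBB⟩ := ih (by lia)
      let Z := (Finset.range i).biUnion B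
      have hZX : Z ⊆ X := Finset.biUnion_subset.2 fun j hj => (hB j (Finset.mem_range.1 hj)).2.1
      have hZc : Z.card ≤ s := by
        have h1 := Finset.card_biUnion_le_card_mul (Finset.range i) B (6 * k)
          fun j hj => (hB j (Finset.mem_range.1 hj)).2.2.2
        rw [Finset.card_range] at h1
        have h2 : i * (6 * k) ≤ k * (6 * k) := Nat.mul_le_mul_right _ (by lia)
        have h3 : k * (6 * k) = 6 * k * k := by ring
        exact h1.trans (by lia)
      have hconn := hrob Z hZX hZc
      have hdegY : ∀ x ∈ X \ Z, m - s ≤ ((X \ Z).filter (K x)).card := fun x hx =>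
        hout Z hZX hZc x (Finset.sdiff_subset hx)
      have hYc : (X \ Z).card < 3 * (m - s + 1) := by
        have := Finset.card_le_card (Finset.sdiff_subset (s := X) (t := Z))
        lia
      obtain ⟨x, hx⟩ : (X \ Z).Nonempty := by
        apply Finset.card_pos.1
        have := Finset.le_card_sdiff Z X
        lia
      have hD : ∀ j < i, ∃ D ⊆ X \ Z, Conn K (D : Set ν) ∧ x ∈ D ∧ D.card ≤ 6 ∧
          ∃ y ∈ D, ∃ b ∈ B j, K y b := by
        intro j hj
        obtain ⟨⟨b, hb⟩, hBX, -⟩ := hB j hj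
        obtain ⟨y, hy⟩ : ((X \ Z).filter (K b)).Nonempty := by
          apply Finset.card_pos.1
          have := hout Z hZX hZc b (hBX hb)
          lia
        obtain ⟨hyY, hby⟩ := Finset.mem_filter.1 hy
        obtain ⟨D, h1, h2, h3, h4, h5⟩ := exists_short_connection hsymm hirr hconn hdegY hYc hx hyY
        exact ⟨D, h1, h2, h3, h5, y, h4, b, hb, hsymm _ _ hby⟩
      choose! D hDY hDconn hxD hDc hDadj using hD
      let C : Finset ν := insert x ((Finset.range i).biUnion D)
      have hCY : C ⊆ X \ Z := Finset.insert_subset hx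
        (Finset.biUnion_subset.2 fun j hj => hDY j (Finset.mem_range.1 hj))
      have hCconn : Conn K (C : Set ν) := by
        have : (C : Set ν) = ⋃ j ∈ {j | j < i + 1}, (if j < i then (D j : Set ν) else {x}) := by
          ext w
          simp only [C, Finset.coe_insert, Finset.coe_biUnion, Set.mem_insert_iff, Set.mem_iUnion,
            Finset.mem_coe, Finset.mem_range, Set.mem_ofPred_eq, exists_prop]
          constructor
          · rintro (rfl | ⟨j, hj, hw⟩)
            · exact ⟨i, by lia, by simp⟩
            · exact ⟨j, by lia, by simpa [hj] using hw⟩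
          · rintro ⟨j, -, hw⟩
            by_cases hj : j < i
            · rw [if_pos hj] at hw
              exact Or.inr ⟨j, hj, hw⟩
            · rw [if_neg hj] at hw
              exact Or.inl hw
        rw [this]
        refine conn_biUnion (t := x) ?_ ?_
        · intro j _
          by_cases hj : j < i
          · rw [if_pos hj]; exact hDconn j hj
          · rw [if_neg hj]; exact conn_singleton x
        · intro j _
          by_cases hj : j < i
          · rw [if_pos hj]; exact hxD j hj
          · rw [if_neg hj]; rfl
      have hCc : C.card ≤ 6 * k := by
        have h1 := Finset.card_insert_le x ((Finset.range i).biUnion D)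
        have h2 := Finset.card_biUnion_le_card_mul (Finset.range i) D 6
          fun j hj => hDc j (Finset.mem_range.1 hj)
        rw [Finset.card_range] at h2
        lia
      have hCB : ∀ j < i, Disjoint C (B j) := by
        intro j hj
        refine Finset.disjoint_left.2 fun w hw hwB => ?_
        exact (Finset.mem_sdiff.1 (hCY hw)).2
          (Finset.mem_biUnion.2 ⟨j, Finset.mem_range.2 hj, hwB⟩)
      refine ⟨Function.update B i C, ?_, ?_⟩
      · intro j hj
        by_cases hji : j = i
        · subst hji
          rw [Function.update_self]
          exact ⟨⟨x, Finset.mem_insert_self _ _⟩, hCY.trans Finset.sdiff_subset, hCconn, hCc⟩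
        · rw [Function.update_of_ne hji]
          exact hB j (by lia)
      · intro j hj j' hj'
        have hj'i : j' ≠ i := by lia
        rw [Function.update_of_ne hj'i]
        by_cases hji : j = i
        · subst hji
          rw [Function.update_self]
          refine ⟨hCB j' hj', ?_⟩
          obtain ⟨y, hy, b, hb, hyb⟩ := hDadj j' hj'
          exact ⟨y, Finset.mem_insert_of_mem
            (Finset.mem_biUnion.2 ⟨j', Finset.mem_range.2 hj', hy⟩), b, hb, hyb⟩
        · rw [Function.update_of_ne hji]
          exact hBB j (by lia) j' hj'
  obtain ⟨B, hB, hBB⟩ := key k le_rfl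
  refine ⟨fun i => (B i : Set ν), fun i => (hB i i.2).1, fun i => (hB i i.2).2.1,
    fun i => (hB i i.2).2.2.1, ?_, ?_⟩
  · intro i j hij
    rw [Finset.disjoint_coe]
    rcases lt_or_gt_of_ne (fun h => hij (Fin.ext h)) with h | h
    · exact (hBB j j.2 i h).1.symm
    · exact (hBB i i.2 j h).1
  · intro i j hij
    rcases lt_or_gt_of_ne (fun h => hij (Fin.ext h)) with h | h
    · obtain ⟨x, hx, y, hy, hxy⟩ := (hBB j j.2 i h).2
      exact ⟨y, hy, x, hx, hsymm _ _ hxy⟩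
    · exact (hBB i i.2 j h).2

open Classical in
/-- A set in which every vertex is adjacent to about half of the others has a clique model. -/
lemma hasCliqueModel_of_dense (hsymm : ∀ x y, K x y → K y x) (hirr : ∀ x, ¬ K x x)
    {X : Finset ν} {m s k : ℕ} (hX : X.card ≤ 2 * m + 1) (hne : X.Nonempty)
    (hdeg : ∀ x ∈ X, m ≤ (X.filter (K x)).card) (hs : 3 * s ≤ m) (hk : 6 * k * k ≤ s)
    (hs0 : 0 < s) (hks : k * s + s ≤ m) : HasCliqueModel K X k := by
  by_cases hrob : ∀ Z ⊆ X, Z.card ≤ s → Conn K ((X \ Z : Finset ν) : Set ν)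
  · exact hasCliqueModel_of_robust hsymm hirr hX hne hdeg hs hk hs0 hrob
  push Not at hrob
  obtain ⟨Z, hZX, hZc, hn⟩ := hrob
  -- If deleting `Z` disconnects `X`, one side has at most `m` of the at most `2 * m + 1` vertices.
  -- Its degrees are still at least `m - s`, so it is nearly complete and the greedy choice applies.
  obtain ⟨Y, hYX, hYne, hYc, hcl⟩ : ∃ Y ⊆ X \ Z, Y.Nonempty ∧ Y.card ≤ m ∧
      ∀ x ∈ Y, ∀ y ∈ X \ Z, K x y → y ∈ Y := by
    simp only [Conn, not_forall] at hn
    obtain ⟨Y, ⟨y, hy, hyY⟩, hcl, hYn⟩ := hn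
    obtain ⟨w, hw, hwY⟩ := Set.not_subset.1 hYn
    have h1 := Finset.card_filter_add_card_filter_not (s := X \ Z) (fun y => y ∈ Y)
    have h2 := Finset.card_le_card (Finset.sdiff_subset (s := X) (t := Z))
    by_cases hc : ((X \ Z).filter (· ∈ Y)).card ≤ m
    · refine ⟨_, Finset.filter_subset _ _, ⟨y, Finset.mem_filter.2 ⟨hy, hyY⟩⟩, hc, ?_⟩
      intro a ha b hb hab
      obtain ⟨ha, haY⟩ := Finset.mem_filter.1 ha
      exact Finset.mem_filter.2 ⟨hb, hcl a ha haY b hb hab⟩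
    · refine ⟨(X \ Z).filter (· ∉ Y), Finset.filter_subset _ _, ⟨w, Finset.mem_filter.2 ⟨hw, hwY⟩⟩,
        by lia, ?_⟩
      intro a ha b hb hab
      obtain ⟨ha, haY⟩ := Finset.mem_filter.1 ha
      exact Finset.mem_filter.2 ⟨hb, fun hbY => haY (hcl b hb hbY a ha (hsymm _ _ hab))⟩
  have hdegY : ∀ x ∈ Y, m - s ≤ (Y.filter (K x)).card := by
    intro x hx
    have hxX : x ∈ X := Finset.sdiff_subset (hYX hx)
    have h1 : X.filter (K x) ⊆ Y.filter (K x) ∪ Z := by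
      intro y hy
      obtain ⟨hyX, hxy⟩ := Finset.mem_filter.1 hy
      by_cases hyZ : y ∈ Z
      · exact Finset.mem_union_right _ hyZ
      · exact Finset.mem_union_left _ (Finset.mem_filter.2
          ⟨hcl x hx y (Finset.mem_sdiff.2 ⟨hyX, hyZ⟩) hxy, hxy⟩)
    have h2 := Finset.card_le_card h1
    have h3 := Finset.card_union_le (Y.filter (K x)) Z
    have h4 := hdeg x hxX
    lia
  obtain ⟨T, hTY, hTc, hT⟩ := exists_clique hirr hsymm (s := s) k Y (by
    intro x hx
    have h1 := Finset.card_filter_add_card_filter_not (s := Y) (fun y => K x y)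
    have h2 := hdegY x hx
    lia) (by
    obtain ⟨x, hx⟩ := hYne
    have h2 := hdegY x hx
    have h3 := Finset.card_filter_le Y (K x)
    lia) (fun _ => hs0)
  let σ := (T.equivFinOfCardEq hTc).symm
  refine ⟨fun i => {(σ i : ν)}, fun i => ⟨_, rfl⟩, ?_, fun i => conn_singleton _, ?_, ?_⟩
  · intro i
    exact Set.singleton_subset_iff.2 (Finset.sdiff_subset (hYX (hTY (σ i).2)))
  · intro i j hij
    rw [Set.disjoint_singleton]
    exact fun h => hij (σ.injective (Subtype.ext h))
  · intro i j hij
    exact ⟨_, rfl, _, rfl, hT _ (σ i).2 _ (σ j).2 fun h => hij (σ.injective (Subtype.ext h))⟩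

end Graph

/-! ### Mader's argument: from many edges to a dense neighbourhood. -/

namespace Graph

universe u v

section Mader

variable {ν : Type u} {A K : ν → ν → Prop} {U : Set ν} {W : Finset ν} {B : ν → Set ν}

/-- The simple graph with vertex set `W` and adjacency `K` is a minor of the graph with adjacency
`A`, with branch sets `B w ⊆ U`. -/
structure IsMinorModel (A : ν → ν → Prop) (U : Set ν) (W : Finset ν) (K : ν → ν → Prop)
    (B : ν → Set ν) : Prop where
  symm : ∀ x y, K x y → K y x
  irrefl : ∀ x, ¬ K x x
  mem : ∀ x y, K x y → x ∈ W
  nonempty : ∀ x ∈ W, (B x).Nonempty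
  subset : ∀ x ∈ W, B x ⊆ U
  conn : ∀ x ∈ W, Conn A (B x)
  disjoint : ∀ x ∈ W, ∀ y ∈ W, x ≠ y → Disjoint (B x) (B y)
  adj : ∀ x y, K x y → ∃ a ∈ B x, ∃ b ∈ B y, A a b

lemma IsMinorModel.hasCliqueModel (h : IsMinorModel A U W K B) {X : Set ν} (hX : X ⊆ W) {k : ℕ}
    (hk : HasCliqueModel K X k) : HasCliqueModel A U k := by
  obtain ⟨C, hne, hCX, hconn, hdisj, hadj⟩ := hk
  refine ⟨fun i => ⋃ w ∈ C i, B w, ?_, ?_, ?_, ?_, ?_⟩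
  · intro i
    obtain ⟨w, hw⟩ := hne i
    obtain ⟨x, hx⟩ := h.nonempty w (hX (hCX i hw))
    exact ⟨x, Set.mem_biUnion hw hx⟩
  · exact fun i => Set.iUnion₂_subset fun w hw => h.subset w (hX (hCX i hw))
  · exact fun i => (hconn i).biUnion (fun w hw => h.conn w (hX (hCX i hw)))
      fun w _ w' _ hww' => h.adj w w' hww'
  · intro i j hij
    rw [Set.disjoint_left]
    intro x hx hx'
    obtain ⟨w, hw, hxw⟩ := Set.mem_iUnion₂.1 hx
    obtain ⟨w', hw', hxw'⟩ := Set.mem_iUnion₂.1 hx'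
    have hne : w ≠ w' := fun h => Set.disjoint_left.1 (hdisj i j hij) hw (h ▸ hw')
    exact Set.disjoint_left.1 (h.disjoint w (hX (hCX i hw)) w' (hX (hCX j hw')) hne) hxw hxw'
  · intro i j hij
    obtain ⟨w, hw, w', hw', hww'⟩ := hadj i j hij
    obtain ⟨a, ha, b, hb, hab⟩ := h.adj w w' hww'
    exact ⟨a, Set.mem_biUnion hw ha, b, Set.mem_biUnion hw' hb, hab⟩

open Classical in
/-- The number of ordered pairs of adjacent vertices. -/
noncomputable def dartCount (W : Finset ν) (K : ν → ν → Prop) : ℕ :=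
  ((W ×ˢ W).filter fun q => K q.1 q.2).card

open Classical in
lemma dartCount_eq_sum : dartCount W K = ∑ w ∈ W, (W.filter (K w)).card := by
  rw [dartCount, Finset.card_filter, Finset.sum_product]
  exact Finset.sum_congr rfl fun x _ => (Finset.card_filter _ _).symm

open Classical in
lemma IsMinorModel.erase (h : IsMinorModel A U W K B) (v : ν) :
    IsMinorModel A U (W.erase v) (fun x y => K x y ∧ x ≠ v ∧ y ≠ v) B ∧
      dartCount W K ≤ dartCount (W.erase v) (fun x y => K x y ∧ x ≠ v ∧ y ≠ v) +
        2 * (W.filter (K v)).card := by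
  refine ⟨⟨fun x y hxy => ⟨h.symm _ _ hxy.1, hxy.2.2, hxy.2.1⟩, fun x hx => h.irrefl x hx.1,
    fun x y hxy => Finset.mem_erase.2 ⟨hxy.2.1, h.mem _ _ hxy.1⟩,
    fun x hx => h.nonempty x (Finset.mem_of_mem_erase hx),
    fun x hx => h.subset x (Finset.mem_of_mem_erase hx),
    fun x hx => h.conn x (Finset.mem_of_mem_erase hx),
    fun x hx y hy => h.disjoint x (Finset.mem_of_mem_erase hx) y (Finset.mem_of_mem_erase hy),
    fun x y hxy => h.adj x y hxy.1⟩, ?_⟩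
  have h1 : ((W ×ˢ W).filter fun q => K q.1 q.2) ⊆
      (((W.erase v) ×ˢ (W.erase v)).filter fun q => K q.1 q.2 ∧ q.1 ≠ v ∧ q.2 ≠ v) ∪
      (((W.filter (K v)).image fun y => (v, y)) ∪ ((W.filter (K v)).image fun y => (y, v))) := by
    rintro ⟨x, y⟩ hq
    have := h.symm x y
    simp only [Finset.mem_filter, Finset.mem_product, Finset.mem_union, Finset.mem_image,
      Finset.mem_erase, Prod.mk.injEq] at hq ⊢
    by_cases hx : x = v
    · subst hx
      exact Or.inr (Or.inl ⟨y, ⟨hq.1.2, hq.2⟩, rfl, rfl⟩)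
    · by_cases hy : y = v
      · subst hy
        exact Or.inr (Or.inr ⟨x, ⟨hq.1.1, this hq.2⟩, rfl, rfl⟩)
      · exact Or.inl ⟨⟨⟨hx, hq.1.1⟩, hy, hq.1.2⟩, hq.2, hx, hy⟩
  have h2 := Finset.card_le_card h1
  have h3 := Finset.card_union_le
    (((W.erase v) ×ˢ (W.erase v)).filter fun q => K q.1 q.2 ∧ q.1 ≠ v ∧ q.2 ≠ v)
    (((W.filter (K v)).image fun y => (v, y)) ∪ ((W.filter (K v)).image fun y => (y, v)))
  have h4 := Finset.card_union_le
    ((W.filter (K v)).image fun y => (v, y)) ((W.filter (K v)).image fun y => (y, v))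
  have h5 := Finset.card_image_le (s := W.filter (K v)) (f := fun y => (v, y))
  have h6 := Finset.card_image_le (s := W.filter (K v)) (f := fun y => (y, v))
  simp only [dartCount]
  lia

-- Only the edge `ab` and one edge for each common neighbour of its ends are lost; every edge counts
-- as two darts.
open Classical in
lemma IsMinorModel.contract (hA : ∀ x y, A x y → A y x) (h : IsMinorModel A U W K B) {a b : ν}
    (hab : K a b) :
    ∃ K' B', IsMinorModel A U (W.erase b) K' B' ∧
      dartCount W K ≤ dartCount (W.erase b) K' + 2 * (W.filter fun y => K a y ∧ K b y).card + 2 := by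
  have hne : a ≠ b := fun hh => h.irrefl a (hh ▸ hab)
  have haW : a ∈ W := h.mem _ _ hab
  have hbW : b ∈ W := h.mem _ _ (h.symm _ _ hab)
  let K' : ν → ν → Prop := fun x y => x ≠ y ∧ x ∈ W.erase b ∧ y ∈ W.erase b ∧
    (K x y ∨ (x = a ∧ K b y) ∨ (y = a ∧ K b x))
  let B' : ν → Set ν := fun x => if x = a then B a ∪ B b else B x
  have hBB : ∀ x, B x ⊆ B' x := by
    intro x
    by_cases hx : x = a
    · subst hx; simp [B']
    · simp [B', hx]
  have hBa : B b ⊆ B' a := by simp [B']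
  refine ⟨K', B', ⟨?_, ?_, ?_, ?_, ?_, ?_, ?_, ?_⟩, ?_⟩
  · rintro x y ⟨h1, h2, h3, h4⟩
    refine ⟨h1.symm, h3, h2, ?_⟩
    rcases h4 with h4 | h4 | h4
    · exact Or.inl (h.symm _ _ h4)
    · exact Or.inr (Or.inr h4)
    · exact Or.inr (Or.inl h4)
  · exact fun x hx => hx.1 rfl
  · exact fun x y hxy => hxy.2.1
  · exact fun x hx => (h.nonempty x (Finset.mem_of_mem_erase hx)).mono (hBB x)
  · intro x hx
    by_cases hxa : x = a
    · subst hxa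
      simp only [B', if_true]
      exact Set.union_subset (h.subset _ haW) (h.subset _ hbW)
    · simp only [B', hxa, if_false]
      exact h.subset x (Finset.mem_of_mem_erase hx)
  · intro x hx
    by_cases hxa : x = a
    · subst hxa
      simp only [B', if_true]
      obtain ⟨s, hs, t, ht, hst⟩ := h.adj _ _ hab
      exact (h.conn _ haW).union_of_adj hA (h.conn _ hbW) hs ht hst
    · simp only [B', hxa, if_false]
      exact h.conn x (Finset.mem_of_mem_erase hx)
  · intro x hx y hy hxy
    obtain ⟨hxb, hxW⟩ := Finset.mem_erase.1 hx
    obtain ⟨hyb, hyW⟩ := Finset.mem_erase.1 hy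
    by_cases hxa : x = a
    · subst hxa
      simp only [B', if_true, if_neg hxy.symm]
      exact Set.disjoint_union_left.2 ⟨h.disjoint _ haW _ hyW hxy, h.disjoint _ hbW _ hyW hyb.symm⟩
    · by_cases hya : y = a
      · subst hya
        simp only [B', if_true, if_neg hxa]
        exact Set.disjoint_union_right.2 ⟨h.disjoint _ hxW _ haW hxy, h.disjoint _ hxW _ hbW hxb⟩
      · simp only [B', hxa, hya, if_false]
        exact h.disjoint _ hxW _ hyW hxy
  · rintro x y ⟨-, -, -, h4 | ⟨rfl, h4⟩ | ⟨rfl, h4⟩⟩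
    · obtain ⟨s, hs, t, ht, hst⟩ := h.adj _ _ h4
      exact ⟨s, hBB x hs, t, hBB y ht, hst⟩
    · obtain ⟨s, hs, t, ht, hst⟩ := h.adj _ _ h4
      exact ⟨s, hBa hs, t, hBB y ht, hst⟩
    · obtain ⟨s, hs, t, ht, hst⟩ := h.adj _ _ h4
      exact ⟨t, hBB x ht, s, hBa hs, hA _ _ hst⟩
  · set T := W.filter fun y => K a y ∧ K b y with hT
    let bad : Finset (ν × ν) := {(a, b), (b, a)} ∪
      ((T.image fun y => (b, y)) ∪ (T.image fun y => (y, b)))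
    have hbad : bad.card ≤ 2 + 2 * T.card := by
      have h1 := Finset.card_union_le ({(a, b), (b, a)} : Finset (ν × ν))
        ((T.image fun y => (b, y)) ∪ (T.image fun y => (y, b)))
      have h2 := Finset.card_union_le (T.image fun y => (b, y)) (T.image fun y => (y, b))
      have h3 := Finset.card_image_le (s := T) (f := fun y => (b, y))
      have h4 := Finset.card_image_le (s := T) (f := fun y => (y, b))
      have h5 : ({(a, b), (b, a)} : Finset (ν × ν)).card ≤ 2 := Finset.card_le_two
      simp only [bad]
      lia
    let Q := (W ×ˢ W).filter fun q => K q.1 q.2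
    -- Redirecting `b` to `a` is injective on the darts outside `bad`.
    let c : ν → ν := fun x => if x = b then a else x
    have hQ : ∀ x y, (x, y) ∈ Q \ bad ↔ K x y ∧ (x = b → y ≠ a ∧ ¬ K a y) ∧
        (y = b → x ≠ a ∧ ¬ K a x) := by
      intro x y
      have h1 := h.mem x y
      have h2 := h.mem y x
      have h3 := h.symm x y
      have h4 := h.symm y x
      simp only [Q, bad, hT, Finset.mem_sdiff, Finset.mem_filter, Finset.mem_product,
        Finset.mem_union, Finset.mem_insert, Finset.mem_singleton, Finset.mem_image,
        Prod.mk.injEq]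
      constructor
      · rintro ⟨⟨⟨hx, hy⟩, hK⟩, hn⟩
        refine ⟨hK, ?_, ?_⟩
        · rintro rfl
          exact ⟨fun hh => hn (Or.inl (Or.inr ⟨rfl, hh⟩)), fun hh =>
            hn (Or.inr (Or.inl ⟨y, ⟨hy, hh, hK⟩, rfl, rfl⟩))⟩
        · rintro rfl
          exact ⟨fun hh => hn (Or.inl (Or.inl ⟨hh, rfl⟩)), fun hh =>
            hn (Or.inr (Or.inr ⟨x, ⟨hx, hh, h3 hK⟩, rfl, rfl⟩))⟩
      · rintro ⟨hK, hb1, hb2⟩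
        refine ⟨⟨⟨h1 hK, h2 (h3 hK)⟩, hK⟩, ?_⟩
        rintro ((⟨rfl, rfl⟩ | ⟨rfl, rfl⟩) | ⟨t, ⟨-, ht, -⟩, rfl, rfl⟩ | ⟨t, ⟨-, ht, -⟩, rfl, rfl⟩)
        · exact (hb2 rfl).1 rfl
        · exact (hb1 rfl).1 rfl
        · exact (hb1 rfl).2 ht
        · exact (hb2 rfl).2 ht
    have hinj : (Q \ bad).card ≤ dartCount (W.erase b) K' := by
      refine Finset.card_le_card_of_injOn (fun q => (c q.1, c q.2)) ?_ ?_
      · rintro ⟨x, y⟩ hq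
        obtain ⟨hK, h1, h2⟩ := (hQ x y).1 hq
        have hxW := h.mem _ _ hK
        have hyW := h.mem _ _ (h.symm _ _ hK)
        have hxy : x ≠ y := fun hh => h.irrefl x (hh ▸ hK)
        have hsy := h.symm x y
        simp only [Finset.coe_filter, Finset.mem_product, Set.mem_ofPred_eq, K',
          Finset.mem_erase, c]
        by_cases hxb : x = b
        · subst hxb
          have h3 := h1 rfl
          simp only [if_true, if_neg hxy.symm]
          exact ⟨⟨⟨hne, haW⟩, hxy.symm, hyW⟩, h3.1.symm, ⟨hne, haW⟩, ⟨hxy.symm, hyW⟩,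
            Or.inr (Or.inl ⟨trivial, hK⟩)⟩
        · by_cases hyb : y = b
          · subst hyb
            have h3 := h2 rfl
            simp only [if_true, if_neg hxb]
            exact ⟨⟨⟨hxb, hxW⟩, hne, haW⟩, h3.1, ⟨hxb, hxW⟩, ⟨hne, haW⟩,
              Or.inr (Or.inr ⟨trivial, hsy hK⟩)⟩
          · simp only [if_neg hxb, if_neg hyb]
            exact ⟨⟨⟨hxb, hxW⟩, hyb, hyW⟩, hxy, ⟨hxb, hxW⟩, ⟨hyb, hyW⟩, Or.inl hK⟩
      · rintro ⟨x, y⟩ hq ⟨x', y'⟩ hq' heq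
        obtain ⟨hK, h1, h2⟩ := (hQ x y).1 hq
        obtain ⟨hK', h1', h2'⟩ := (hQ x' y').1 hq'
        have e1 := h.symm x y hK
        have e2 := h.symm x' y' hK'
        have i1 := h.irrefl b
        simp only [Prod.mk.injEq, c] at heq ⊢
        obtain ⟨heq1, heq2⟩ := heq
        split_ifs at heq1 heq2 <;> subst_vars <;> grind
    have h1 := Finset.le_card_sdiff bad Q
    have h2 : dartCount W K = Q.card := rfl
    lia

open Classical in
/-- A graph with `m` times as many edges as vertices has a minor in which the neighbourhood of some
vertex is dense. -/
lemma IsMinorModel.exists_dense (hA : ∀ x y, A x y → A y x) (h : IsMinorModel A U W K B)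
    (hW : W.Nonempty) {m : ℕ} (hm : 1 ≤ m) (hc : 2 * m * W.card ≤ dartCount W K) :
    ∃ (W' : Finset ν) (K' : ν → ν → Prop) (B' : ν → Set ν) (X : Finset ν),
      IsMinorModel A U W' K' B' ∧ X ⊆ W' ∧ X.Nonempty ∧ X.card ≤ 2 * m + 1 ∧
      ∀ x ∈ X, m ≤ (X.filter (K' x)).card := by
  -- Take such a minor with the fewest vertices: deleting a vertex or contracting an edge must
  -- violate the density bound.
  have hex : ∃ n, ∃ (W : Finset ν) (K : ν → ν → Prop) (B : ν → Set ν), IsMinorModel A U W K B ∧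
      W.Nonempty ∧ 2 * m * W.card ≤ dartCount W K ∧ W.card = n := ⟨_, W, K, B, h, hW, hc, rfl⟩
  obtain ⟨W, K, B, h, hW, hc, hcard⟩ := Nat.find_spec hex
  have hmin : ∀ (W' : Finset ν) (K' : ν → ν → Prop) (B' : ν → Set ν), IsMinorModel A U W' K' B' →
      W'.Nonempty → W'.card < W.card → dartCount W' K' < 2 * m * W'.card := by
    intro W' K' B' h' hne' hlt
    by_contra! hcon
    exact Nat.find_min hex (hcard ▸ hlt) ⟨W', K', B', h', hne', hcon, rfl⟩
  clear hcard
  obtain ⟨v, hv, hvmin⟩ := Finset.exists_min_image W (fun w => (W.filter (K w)).card) hW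
  have hdeglt : ∀ w ∈ W, (W.filter (K w)).card + 1 ≤ W.card := fun w hw =>
    Finset.card_lt_card (Finset.filter_ssubset.2 ⟨w, hw, h.irrefl w⟩)
  set n := W.card with hn
  have hn0 : 0 < n := Finset.card_pos.2 hW
  have h1 : n * (W.filter (K v)).card ≤ dartCount W K := by
    rw [dartCount_eq_sum, ← smul_eq_mul]
    exact Finset.card_nsmul_le_sum _ _ _ hvmin
  have h2 : dartCount W K ≤ n * (n - 1) := by
    rw [dartCount_eq_sum, ← smul_eq_mul]
    exact Finset.sum_le_card_nsmul _ _ _ fun w hw => by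
      have := hdeglt w hw
      lia
  have h3 : 2 * m ≤ n - 1 := by
    have : n * (2 * m) ≤ n * (n - 1) := by
      calc n * (2 * m) = 2 * m * n := by ring
        _ ≤ _ := hc.trans h2
    exact Nat.le_of_mul_le_mul_left this hn0
  have herase : ∀ w ∈ W, (W.erase w).card = n - 1 ∧ (W.erase w).Nonempty := by
    intro w hw
    have := Finset.card_erase_of_mem hw
    exact ⟨this, Finset.card_pos.1 (by lia)⟩
  have hpred : 2 * m * (n - 1) + 2 * m = 2 * m * n := by
    rw [← Nat.mul_succ, Nat.succ_eq_add_one, Nat.sub_add_cancel hn0]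
  have h4 : dartCount W K < 2 * m * (n - 1) + 2 * (W.filter (K v)).card := by
    obtain ⟨h5, h6⟩ := h.erase v
    have h7 := hmin _ _ _ h5 (herase v hv).2 (by rw [(herase v hv).1]; lia)
    rw [(herase v hv).1] at h7
    lia
  -- Contracting `vx` loses more than `2 * m` darts, so the edge lies in at least `m` triangles.
  have htri : ∀ x, K v x → m ≤ (W.filter fun y => K x y ∧ K v y).card := by
    intro x hvx
    obtain ⟨K', B', h5, h6⟩ := h.contract hA (h.symm _ _ hvx)
    have h7 := hmin _ _ _ h5 (herase v hv).2 (by rw [(herase v hv).1]; lia)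
    rw [(herase v hv).1] at h7
    lia
  refine ⟨W, K, B, W.filter (K v), h, Finset.filter_subset _ _, ?_, ?_, ?_⟩
  · apply Finset.card_pos.1
    lia
  · by_contra! hcon
    -- Comparing `h1` with `h4` gives $(n-2)\deg v<2m(n-1)$; as $n\ge2m+1$, this excludes $\deg
    -- v\ge2m+2$.
    have h8 : n = (n - 2) + 2 := by lia
    have h9 : (n - 2) * (2 * m + 2) ≤ (n - 2) * (W.filter (K v)).card :=
      Nat.mul_le_mul_left _ hcon
    have h10 : n * (W.filter (K v)).card =
        (n - 2) * (W.filter (K v)).card + 2 * (W.filter (K v)).card := by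
      conv_lhs => rw [h8, Nat.add_mul]
    have h11 : (n - 2) * (2 * m + 2) = 2 * m * (n - 2) + 2 * (n - 2) := by ring
    have h12 : 2 * m * (n - 1) = 2 * m * (n - 2) + 2 * m := by
      rw [← Nat.mul_succ]
      congr 1
      lia
    lia
  · intro x hx
    obtain ⟨hxW, hvx⟩ := Finset.mem_filter.1 hx
    refine (htri x hvx).trans (Finset.card_le_card ?_)
    intro y hy
    simp only [Finset.mem_filter] at hy ⊢
    exact ⟨⟨hy.1, hy.2.2⟩, hy.2.1⟩

/-- A minor with many edges yields a clique model of polynomial order. -/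
lemma IsMinorModel.hasCliqueModel_of_le (hA : ∀ x y, A x y → A y x) (h : IsMinorModel A U W K B)
    (hW : W.Nonempty) {k : ℕ} (hk : 1 ≤ k) (hc : 2 * (24 * k ^ 3) * W.card ≤ dartCount W K) :
    HasCliqueModel A U k := by
  have hk3 : k ^ 3 = k * (k * k) := by ring
  have hk2 : k * k ≤ k ^ 3 := by rw [hk3]; exact Nat.le_mul_of_pos_left _ hk
  have hkk : 1 ≤ k * k := Nat.mul_pos hk hk
  obtain ⟨W', K', B', X, h', hXW, hXne, hXc, hdeg⟩ := h.exists_dense hA hW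
    (m := 24 * k ^ 3) (by lia) hc
  refine h'.hasCliqueModel (X := X) (by exact_mod_cast hXW) ?_
  refine hasCliqueModel_of_dense h'.symm h'.irrefl (s := 6 * (k * k)) hXc hXne hdeg (by lia)
    (by rw [Nat.mul_assoc]) (by lia) ?_
  have : k * (6 * (k * k)) = 6 * k ^ 3 := by ring
  lia

end Mader

end Graph

/-! ### Contraction of the trees, choice of the parameters and conclusion. -/

namespace Graph

universe u v

variable {ν : Type u} {ε : Type v} {G : Graph ν ε} {r N α ℓ j k : ℕ}

open Classical in
lemma ThetaSparse.hasCliqueModel (hT : ThetaSparse G r N) (hfin : V(G).Finite)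
    (hE : E(G).Finite) (hl : G.Loopless) (hconn : Conn G.Adj V(G)) (hr : 2 ≤ r) (hα : 1 ≤ α)
    (hG : G.LooselyConnected α (2 * r - 1)) (hN : 168 * α * r ≤ N) (hEN : N ≤ E(G).ncard)
    (hℓ : 8 * r * ℓ ≤ N) (hj : (j + 2) * (2 * α) ≤ ℓ) (hk : 1 ≤ k)
    (hkj : 2 * (24 * k ^ 3) * r ≤ 2 ^ j) : HasCliqueModel G.Adj V(G) k := by
  obtain ⟨hn1, hn2⟩ := hT.le_ncard_vertexSet hfin hE hl hconn hr hα hG hN hEN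
  obtain ⟨p, d, hF⟩ := exists_isForest hfin ℓ
  have hrαr : r ≤ α * r := Nat.le_mul_of_pos_left _ hα
  have hrad : 2 * (r * (2 * ℓ + 1)) + r < N + 2 := by
    have h1 : 2 * (r * (2 * ℓ + 1)) = 4 * (r * ℓ) + 2 * r := by ring
    have h2 : 8 * r * ℓ = 8 * (r * ℓ) := by ring
    have h3 : 168 * α * r = 168 * (α * r) := by ring
    lia
  have hexp : (j + 2) * (2 * α) = 2 * (j * α) + 4 * α := by ring
  have hjα : j ≤ j * α := Nat.le_mul_of_pos_right _ hα
  let W : Finset ν := hfin.toFinset.filter fun x => d x = 0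
  have hW : ∀ x, x ∈ W ↔ x ∈ V(G) ∧ d x = 0 := by simp [W]
  let K : ν → ν → Prop := fun x y => x ≠ y ∧ x ∈ W ∧ y ∈ W ∧
    ∃ a ∈ G.below p d x, ∃ b ∈ G.below p d y, G.Adj a b
  have hmodel : IsMinorModel G.Adj V(G) W K (G.below p d) :=
    { symm := fun x y ⟨h1, h2, h3, a, ha, b, hb, hab⟩ => ⟨h1.symm, h3, h2, b, hb, a, ha, hab.symm⟩
      irrefl := fun x h => h.1 rfl
      mem := fun x y h => h.2.1
      nonempty := fun x hx => ⟨x, mem_below_self ((hW x).1 hx).1⟩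
      subset := fun x _ => below_subset x
      conn := fun x hx => (hF.hasRadius_below ((hW x).1 hx).1).conn
      disjoint := fun x hx y hy hxy => Set.disjoint_left.2 fun w hw hw' =>
        hxy (eq_of_mem_below (by rw [((hW x).1 hx).2, ((hW y).1 hy).2]) hw hw')
      adj := fun x y h => h.2.2.2 }
  have hdeg : ∀ v ∈ W, 2 * (24 * k ^ 3) ≤ (W.filter (K v)).card := by
    intro v hv
    obtain ⟨hvV, hdv⟩ := (hW v).1 hv
    obtain ⟨x, hx, hdx, hxα⟩ := hF.exists_heavy hT hfin hE hconn hr hα hG hn2 hrad hn1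
      (by lia) hvV hdv
    have hroot : p^[d x] x = v := by
      have := hx.2.2
      rwa [hdv, Nat.sub_zero] at this
    have h1 := hF.two_pow_le_ncard_between hT hfin hE hr hG hn2 hrad j x hx.1 hxα (by lia)
      (by rw [hdx, Nat.mul_succ]; lia)
    rw [hroot] at h1
    -- Sort the leaving edges by the tree in which they end; each tree receives at most `r` of them,
    -- so at least $2^j/r$ trees are adjacent to that of `v`.
    have h2 : G.between (G.below p d x) (V(G) \ G.below p d v) ⊆
        ⋃ u ∈ (W.filter (K v) : Set ν), G.between (G.below p d v) (G.below p d u) := by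
      rintro e ⟨a, ha, b, hb, he⟩
      have hav := hF.below_subset_below hx ha
      obtain ⟨hu, hdu⟩ := hF.root_mem hb.1
      have hbu := hF.mem_below_iterate hb.1 (le_refl (d b))
      have huW : p^[d b] b ∈ W := (hW _).2 ⟨hu, hdu⟩
      refine Set.mem_biUnion (x := p^[d b] b) ?_ ⟨a, hav, b, hbu, he⟩
      refine Finset.mem_coe.2 (Finset.mem_filter.2 ⟨huW, ?_, hv, huW, a, hav, b, hbu, e, he⟩)
      intro heq
      exact hb.2 (heq ▸ hbu)
    have h3 : ∀ u ∈ (W.filter (K v) : Set ν),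
        (G.between (G.below p d v) (G.below p d u)).ncard ≤ r := by
      intro u hu
      obtain ⟨huW, hne, -⟩ := Finset.mem_filter.1 (Finset.mem_coe.1 hu)
      exact (hT.ncard_between_lt hE (below_subset v) (below_subset u) (hF.hasRadius_below hvV)
        (hF.hasRadius_below ((hW u).1 huW).1) (hmodel.disjoint v hv u huW hne) hrad).le
    have h4 := ncard_biUnion_le_mul (Finset.finite_toSet _) h3
    have h5 := Set.ncard_le_ncard h2 (hE.subset
      (Set.iUnion₂_subset fun u _ => between_subset _ _))
    rw [Set.ncard_coe_finset] at h4
    have h6 := (hkj.trans h1).trans (h5.trans h4)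
    exact Nat.le_of_mul_le_mul_right h6 (by lia)
  have hWne : W.Nonempty := by
    obtain ⟨x, hx⟩ : V(G).Nonempty := Set.nonempty_of_ncard_ne_zero (by lia)
    exact ⟨p^[d x] x, (hW _).2 (hF.root_mem hx)⟩
  refine hmodel.hasCliqueModel_of_le (adj_symm G) hWne hk ?_
  rw [dartCount_eq_sum, Nat.mul_comm, ← smul_eq_mul]
  exact Finset.card_nsmul_le_sum _ _ _ fun v hv =>
    (hdeg v hv).trans_eq (by congr)

/-- The choice of the parameters in the growth argument. -/
lemma exists_parameters {r α : ℕ} {z : ℝ} (hr : 2 ≤ r) (hα : 1 ≤ α)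
    (hz : 168 * (α : ℝ) * r ≤ z)
    (hbig : Real.sqrt (r * z) < (2 : ℝ) ^ ((1 / 1000 : ℝ) * (z / (r * α)))) :
    ∃ ℓ j k : ℕ, 8 * r * ℓ ≤ ⌈z⌉₊ ∧ (j + 2) * (2 * α) ≤ ℓ ∧ 1 ≤ k ∧
      2 * (24 * k ^ 3) * r ≤ 2 ^ j ∧ (2 : ℝ) ^ ((1 / 1000 : ℝ) * (z / (r * α))) ≤ k := by
  have hr' : (2 : ℝ) ≤ r := by exact_mod_cast hr
  have hα' : (1 : ℝ) ≤ α := by exact_mod_cast hα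
  have hαr : (2 : ℝ) ≤ α * r := by nlinarith
  have hz' : 336 ≤ z := by nlinarith
  set q : ℝ := z / (r * α) with hq
  set t : ℝ := (2 : ℝ) ^ ((1 / 1000 : ℝ) * q) with ht
  have htpos : 0 < t := Real.rpow_pos_of_pos two_pos _
  have hrz : r * z < t ^ 2 := by
    have := Real.lt_sq_of_sqrt_lt hbig
    exact this
  have hq0 : 168 ≤ q := by
    rw [hq, le_div_iff₀ (by positivity)]
    linarith
  have ht2 : t ^ 2 = (2 : ℝ) ^ ((2 / 1000 : ℝ) * q) := by
    rw [ht, ← Real.rpow_natCast, ← Real.rpow_mul two_pos.le]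
    congr 1
    push_cast
    ring
  -- Outside the trivial case $t^2>rz>2^9$, which makes $q$ large; likewise $r<t^2$ lets a power of
  -- $t$ absorb the factor $r$.
  have hq1 : 4500 < q := by
    have h1 : (2 : ℝ) ^ (9 : ℝ) < (2 : ℝ) ^ ((2 / 1000 : ℝ) * q) := by
      rw [← ht2]
      refine lt_of_le_of_lt ?_ hrz
      have : (2 : ℝ) ^ (9 : ℝ) = 512 := by norm_num
      rw [this]
      nlinarith
    have := (Real.rpow_lt_rpow_left_iff one_lt_two).1 h1
    linarith
  have hr_lt : (r : ℝ) < t ^ 2 := by nlinarith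
  have ht1 : 1 ≤ t := Real.one_le_rpow one_le_two (by positivity)
  let ℓ := ⌈z⌉₊ / (8 * r)
  let j := ℓ / (2 * α) - 2
  have hℓ : z / (8 * r) - 1 ≤ ℓ := by
    have h1 : ⌈z⌉₊ < (ℓ + 1) * (8 * r) := by
      have := Nat.lt_div_mul_add (a := ⌈z⌉₊) (b := 8 * r) (by lia)
      rw [Nat.add_mul, one_mul]
      exact this
    have h2 : z < ((ℓ + 1 : ℕ) : ℝ) * (8 * r) := by
      have h3 : ((⌈z⌉₊ : ℕ) : ℝ) < (((ℓ + 1) * (8 * r) : ℕ) : ℝ) := by exact_mod_cast h1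
      push_cast at h3 ⊢
      exact lt_of_le_of_lt (Nat.le_ceil z) h3
    have h3 : z / (8 * r) < ((ℓ + 1 : ℕ) : ℝ) := by
      rw [div_lt_iff₀ (by positivity)]
      exact h2
    push_cast at h3
    linarith
  -- Here $z/(8r)=(q/16)\cdot2\alpha$, and the two roundings cost at most $2$.
  have hL : q / 16 - 2 ≤ ((ℓ / (2 * α) : ℕ) : ℝ) := by
    have h1 : ℓ < (ℓ / (2 * α) + 1) * (2 * α) := by
      have := Nat.lt_div_mul_add (a := ℓ) (b := 2 * α) (by lia)
      rw [Nat.add_mul, one_mul]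
      exact this
    have h2 : (ℓ : ℝ) < ((ℓ / (2 * α) : ℕ) + 1 : ℝ) * (2 * α) := by exact_mod_cast h1
    have h3 : z / (8 * r) = q / 16 * (2 * α) := by
      rw [hq]
      field_simp
      ring
    rw [h3] at hℓ
    have h4 : q / 16 * (2 * α) < ((ℓ / (2 * α) : ℕ) + 2 : ℝ) * (2 * α) := by nlinarith
    have h5 := lt_of_mul_lt_mul_right h4 (by positivity)
    linarith
  have hL2 : 2 ≤ ℓ / (2 * α) := by
    have : (2 : ℝ) ≤ ((ℓ / (2 * α) : ℕ) : ℝ) := by linarith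
    exact_mod_cast this
  have hjL : j + 2 = ℓ / (2 * α) := by simp only [j]; lia
  have hjq : q / 32 ≤ (j : ℝ) := by
    have : (j : ℝ) + 2 = ((ℓ / (2 * α) : ℕ) : ℝ) := by exact_mod_cast hjL
    linarith
  have hk1 : 1 ≤ ⌈t⌉₊ := Nat.one_le_ceil_iff.2 htpos
  refine ⟨ℓ, j, ⌈t⌉₊, Nat.mul_div_le _ _, ?_, hk1, ?_, Nat.le_ceil t⟩
  · rw [hjL]
    exact Nat.div_mul_le_self _ _
  · have hkt : ((⌈t⌉₊ : ℕ) : ℝ) ≤ 2 * t := by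
      have := Nat.ceil_lt_add_one htpos.le
      linarith
    have h1 : ((⌈t⌉₊ : ℕ) : ℝ) ^ 3 ≤ (2 * t) ^ 3 := pow_le_pow_left₀ (Nat.cast_nonneg _) hkt 3
    have h2 : (2 * (24 * (⌈t⌉₊ : ℝ) ^ 3) * r : ℝ) ≤ 2 ^ 9 * t ^ 5 := by
      calc (2 * (24 * (⌈t⌉₊ : ℝ) ^ 3) * r : ℝ) ≤ 2 * (24 * (2 * t) ^ 3) * t ^ 2 := by
            gcongr
        _ = 384 * t ^ 5 := by ring
        _ ≤ 2 ^ 9 * t ^ 5 := by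
            have : 0 < t ^ 5 := by positivity
            linarith
    -- In exponents: $9+5q/1000\le q/32\le j$.
    have h3 : (2 ^ 9 * t ^ 5 : ℝ) ≤ 2 ^ j := by
      have e1 : t ^ 5 = (2 : ℝ) ^ ((5 / 1000 : ℝ) * q) := by
        rw [ht, ← Real.rpow_natCast, ← Real.rpow_mul two_pos.le]
        congr 1
        push_cast
        ring
      rw [e1, ← Real.rpow_natCast 2 9, ← Real.rpow_natCast 2 j, ← Real.rpow_add two_pos]
      refine Real.rpow_le_rpow_of_exponent_le one_le_two ?_
      push_cast
      linarith
    exact_mod_cast h2.trans h3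

end Graph

theorem theorem2 :
    ∃ c : ℝ, 0 < c ∧
      ∀ (r α : ℕ) (z : ℝ), 2 ≤ r → 1 ≤ α → 168 * (α : ℝ) * (r : ℝ) * Real.logb 2 (r : ℝ) ≤ z →
      ∀ {ν ε : Type*} (G : Graph ν ε), V(G).Finite → E(G).Finite → G.Loopless →
        G.toSimpleGraph.Connected →
        z ≤ (E(G).ncard : ℝ) →
        G.LooselyConnected α (2 * r - 1) →
        ((⌈z⌉₊ : ℕ) : ℕ∞) ≤ Graph.minorGirth (Graph.theta r) G →
        ∃ k : ℕ, (2 : ℝ) ^ (c * (z / ((r : ℝ) * (α : ℝ)))) / Real.sqrt ((r : ℝ) * z) ≤ (k : ℝ) ∧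
          (Graph.clique k).IsMinorOf G := by
  refine ⟨1 / 1000, by norm_num, ?_⟩
  intro r α z hr hα hz ν ε G hfin hE hl hconn hEz hG hg
  have hr' : (2 : ℝ) ≤ r := by exact_mod_cast hr
  have hα' : (1 : ℝ) ≤ α := by exact_mod_cast hα
  -- The logarithm matters only through $168\alpha r\le z$.
  have hlog : 1 ≤ Real.logb 2 (r : ℝ) := by
    rw [Real.le_logb_iff_rpow_le one_lt_two (by positivity)]
    simpa using hr'
  have hz1 : 168 * (α : ℝ) * r ≤ z :=
    (le_mul_of_one_le_right (by positivity) hlog).trans hz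
  have hαr : (2 : ℝ) ≤ α * r := by nlinarith
  have hrz : 1 ≤ (r : ℝ) * z := by nlinarith
  have hN : 168 * α * r ≤ ⌈z⌉₊ := by
    have : ((168 * α * r : ℕ) : ℝ) ≤ (⌈z⌉₊ : ℝ) := by
      push_cast
      exact hz1.trans (Nat.le_ceil z)
    exact_mod_cast this
  have hEN : ⌈z⌉₊ ≤ E(G).ncard := Nat.ceil_le.2 hEz
  have hEne : E(G).Nonempty := by
    refine Set.nonempty_of_ncard_ne_zero fun h0 => ?_
    rw [h0] at hEz
    push_cast at hEz
    nlinarith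
  have hsqrt : 1 ≤ Real.sqrt ((r : ℝ) * z) := Real.one_le_sqrt.2 hrz
  have hpos : 0 < (2 : ℝ) ^ ((1 / 1000 : ℝ) * (z / ((r : ℝ) * (α : ℝ)))) :=
    Real.rpow_pos_of_pos two_pos _
  have finish : ∀ k : ℕ, 0 < k → Graph.HasCliqueModel G.Adj V(G) k →
      (Graph.clique k).IsMinorOf G := by
    rintro k hk ⟨B, h1, h2, h3, h4, h5⟩
    exact Graph.clique_isMinorOf hfin hE hl hEne hk B h1 h2 h3 h4 h5
  -- If the required order is at most $1$, a single vertex suffices. Otherwise the clique has order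
  -- at least $2^{cz/(r\alpha)}$, even without dividing by the root.
  by_cases hbig : (2 : ℝ) ^ ((1 / 1000 : ℝ) * (z / ((r : ℝ) * (α : ℝ)))) ≤ Real.sqrt ((r : ℝ) * z)
  · refine ⟨1, ?_, finish 1 one_pos ?_⟩
    · rw [div_le_iff₀ (by linarith)]
      simpa using hbig
    · obtain ⟨e, he⟩ := hEne
      obtain ⟨x, y, h⟩ := Graph.exists_isLink_of_mem_edgeSet he
      refine ⟨fun _ => {x}, fun _ => ⟨x, rfl⟩, fun _ => by simpa using h.left_mem,
        fun _ => Graph.conn_singleton x, fun i j hij => absurd (Subsingleton.elim i j) hij,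
        fun i j hij => absurd (Subsingleton.elim i j) hij⟩
  · obtain ⟨ℓ, j, k, hℓ, hj, hk, hkj, hkt⟩ := Graph.exists_parameters hr hα hz1 (not_le.1 hbig)
    refine ⟨k, (div_le_self hpos.le hsqrt).trans hkt, finish k hk ?_⟩
    exact (Graph.thetaSparse_of_le_minorGirth hfin hE hl (by lia) hg).hasCliqueModel hfin hE hl
      (Graph.conn_vertexSet hconn) hr hα hG hN hEN hℓ hj hk hkj
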